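/- A lattice is geometric if it is atomic (every element is the join of the atoms below it) and semimodular ($x\wedge y\lessdot x$ implies $y\lessdot x\vee y$). Let $P$ be a finite bouquet of geometric lattices, i.e. a non-empty finite meet semilattice in which every interval is a geometric lattice. Let $\hat 0$ be its minimum, $r$ its rank function and $\mu$ its Möbius function. For $x\in P$ put $$\beta(x)=(-1)^{r(x)}\sum_{y\le x}\mu(\hat 0,y)\,r(y),\qquad \rho_P(x)=\beta(x)\sum_{i}|\mu(x,r_i)|,$$ where the $r_i$ run through the maximal elements of $P$ with $x\le r_i$. Take one variable $w_a$ for every atom $a$ of $P$ and let $w(x)=\sum_{a\le x}w_a$, the sum being over the atoms below $x$, in the polynomial ring over $\mathbb Z$ in these variables. Fix an arbitrary labeling $l$ of the elements $x\neq\hat 0$ of $P$ by atoms with $l(x)\le x$. A maximal chain is $C=[x_1\lessdot\dots\lessdot x_k]$ with $\hat 0=x_0\lessdot x_1$ and $x_k$ maximal in $P$ ($x_0=\hat 0$ is not listed); its size is $|C|=k$. It is neat if $l(x_i)\not\le x_{i-1}$ for $i=1,\dots,k$. A tuple of atoms $(a_1,\dots,a_k)$ generates $C$, written $ch(a_1,\dots,a_k)=C$,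 if $x_i=a_1\vee\dots\vee a_i$ for $i=1,\dots,k$. The chain matrix $\mathfrak C$ is indexed by the neat maximal chains. Its entry at $(C,C')$ is $$\mathfrak C_{C,C'}=\sum \operatorname{sgn}(\sigma)\,w_{a_1}\cdots w_{a_k},\qquad k=|C|,$$ where the sum is over all $k$-tuples of atoms $(a_1,\dots,a_k)$ and all permutations $\sigma$ of $\{1,\dots,k\}$ with $ch(a_1,\dots,a_k)=C$ and $ch(a_{\sigma(1)},\dots,a_{\sigma(k)})=C'$ (so the entry is $0$ if $|C|\ne|C'|$). Then $\rho_P(x)$ is a non-negative integer for every $x\in P$, and $$\det(\mathfrak C)=\pm\prod_{x\in P}w(x)^{\rho_P(x)},$$ where $w(\hat 0)^{\rho_P(\hat 0)}=0^0=1$. -/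

import Mathlib

namespace Bouquet

/-- A poset `L` is a geometric lattice if it is a lattice (every two elements have a meet and a
join), it is atomic (every element is the join of the atoms below it, an atom being an element
that covers the minimum) and it is semimodular (if `x ∧ y ⋖ x` then `y ⋖ x ∨ y`). -/
structure IsGeometricLattice (L : Type*) [PartialOrder L] : Prop where
  exists_meet : ∀ x y : L, ∃ m, IsGLB {x, y} m
  exists_join : ∀ x y : L, ∃ j, IsLUB {x, y} j
  atomic : ∀ x : L, IsLUB {a : L | (∃ b, IsBot b ∧ b ⋖ a) ∧ a ≤ x} x
  semimodular : ∀ x y m j : L, IsGLB {x, y} m → IsLUB {x, y} j → m ⋖ x → y ⋖ j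

/-- A bouquet of geometric lattices: a meet semilattice in which every interval is a geometric
lattice. -/
structure IsBouquet (P : Type*) [PartialOrder P] : Prop where
  exists_meet : ∀ x y : P, ∃ m, IsGLB {x, y} m
  interval : ∀ x y : P, x ≤ y → IsGeometricLattice (Set.Icc x y)

/-- The atoms of `P`. -/
abbrev Atom (P : Type*) [PartialOrder P] [OrderBot P] : Type _ := {a : P // IsAtom a}

noncomputable instance instFintypeAtom (P : Type*) [PartialOrder P] [OrderBot P] [Fintype P] :
    Fintype (Atom P) := Fintype.ofFinite _

/-- The rank `r(x)`: the length of a longest chain from the minimum to `x`. -/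
noncomputable def rank {P : Type*} [PartialOrder P] (x : P) : ℕ := (Order.height x).toNat

section Invariants

variable {P : Type*} [PartialOrder P] [OrderBot P] [Fintype P] [DecidableEq P]
  [LocallyFiniteOrder P]

/-- Crapo's beta function `β(x) = (-1) ^ r(x) * ∑_{y ≤ x} μ(0̂, y) r(y)`. -/
noncomputable def beta (x : P) : ℤ :=
  (-1) ^ rank x * ∑ y ∈ Finset.Icc ⊥ x, IncidenceAlgebra.mu ℤ ⊥ y * (rank y : ℤ)

open Classical in
/-- The cumulated rho function: `β(x)` times the sum of `|μ(x, r)|` over the maximal elements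
`r ≥ x` of `P`. -/
noncomputable def rho (x : P) : ℤ :=
  beta x * ∑ r : P with IsMax r ∧ x ≤ r, |IncidenceAlgebra.mu ℤ x r|

end Invariants

section Chains

variable {P : Type*} [PartialOrder P] [OrderBot P]

/-- The list `C = [x₁, …, x_k]` is a maximal chain `x₁ ⋖ ⋯ ⋖ x_k` with the minimum `x₀ = ⊥` left
out: `⊥ ⋖ x₁ ⋖ ⋯ ⋖ x_k` and the last element is maximal in `P`. -/
def IsMaxChain (C : List P) : Prop :=
  List.IsChain (· ⋖ ·) (⊥ :: C) ∧ IsMax ((⊥ :: C).getLast (List.cons_ne_nil _ _))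

/-- A labeling assigns to every element other than the minimum an atom below it (the value at
the minimum is irrelevant). -/
def IsLabeling (l : P → P) : Prop :=
  ∀ x : P, x ≠ ⊥ → IsAtom (l x) ∧ l x ≤ x

/-- `C = [x₁, …, x_k]` is neat: `l(x_i) ≤ x_i` and `l(x_i) ≰ x_{i-1}` for all `i`, with
`x₀ = ⊥`. -/
def IsNeat (l : P → P) (C : List P) : Prop :=
  List.IsChain (fun y x => l x ≤ x ∧ ¬ l x ≤ y) (⊥ :: C)

/-- The neat maximal chains of `P`. -/
abbrev NeatChain (l : P → P) : Type _ := {C : List P // IsMaxChain C ∧ IsNeat l C}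

lemma IsMaxChain.nodup {C : List P} (h : IsMaxChain C) : C.Nodup := by
  have h1 : List.IsChain (· < ·) (⊥ :: C) := h.1.imp fun _ _ hab => hab.lt
  have h2 : (⊥ :: C).Pairwise (· < ·) := List.isChain_iff_pairwise.1 h1
  exact (List.pairwise_cons.1 h2).2.imp fun hab => hab.ne

instance instFiniteNeatChain [Finite P] (l : P → P) : Finite (NeatChain l) := by
  classical
  have := Fintype.ofFinite P
  exact Finite.of_injective
    (fun C : NeatChain l => (⟨C.1, C.2.1.nodup⟩ : {L : List P // L.Nodup}))
    fun C D h => Subtype.ext (congrArg (fun L => L.1) h)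

noncomputable instance instFintypeNeatChain [Fintype P] (l : P → P) : Fintype (NeatChain l) := Fintype.ofFinite _

/-- The tuple of atoms `(a₁, …, a_k)` generates `C = [x₁, …, x_k]`: the join `a₁ ∨ ⋯ ∨ a_i`
exists in `P` and equals `x_i`, for all `i`. -/
def Generates {k : ℕ} (a : Fin k → Atom P) (C : List P) : Prop :=
  ∃ x : Fin k → P, C = List.ofFn x ∧
    ∀ i, IsLUB ((fun j => (a j : P)) '' Set.Iic i) (x i)

variable [Fintype P]

open Classical in
/-- The weight `w(x) = ∑_{a ≤ x} w_a` in the polynomial ring over `ℤ` with one variable for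
each atom. -/
noncomputable def weight (x : P) : MvPolynomial (Atom P) ℤ :=
  ∑ a ∈ (Finset.univ : Finset (Atom P)).filter (fun a => a.1 ≤ x), MvPolynomial.X a

open Classical in
/-- The chain matrix. The entry at `(C, C')` is the sum of `sgn(σ) w_{a₁} ⋯ w_{a_k}` over all
tuples `a` of atoms and permutations `σ` such that `a` generates `C` and the permuted tuple
generates `C'`, where `k` is the size of `C`. If the sizes differ there are no such pairs and
the entry is `0`. -/
noncomputable def chainMatrix (l : P → P) :
    Matrix (NeatChain l) (NeatChain l) (MvPolynomial (Atom P) ℤ) :=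
  Matrix.of fun C C' =>
    ∑ a : Fin C.1.length → Atom P, ∑ σ : Equiv.Perm (Fin C.1.length),
      if Generates a C.1 ∧ Generates (a ∘ σ) C'.1 then
        (Equiv.Perm.sign σ : ℤ) • ∏ i, MvPolynomial.X (a i)
      else 0

end Chains

end Bouquet

/-!
The determinant is computed in the Orlik–Solomon algebra. An element of its component at `x` is
encoded by its iterated residues, as a function on the saturated chains from `x` down to `⊥` that
satisfies exchange relations (`flagModule`). The atoms act by multiplication: for `y ⋖ x` the
weighted sum of all atoms gives a map `ext` from the component at `y` to the component at `x`, and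
restriction to the chains through `y` gives a map `cut` back. A flag function at `x` is determined
by its restrictions to the `y ⋖ x` not above one fixed atom `a ≤ x`, and these are arbitrary
(`IsBouquet.eq_zero_of_cut_eq_zero`, `IsBouquet.exists_cut_eq`); taking `a = l x` at every step, the
evaluations at the neat chains are coordinates (`IsBouquet.neatBasis`).

*Entries.* Multiplying along a chain `C` to `x` gives a flag function, and this is a minor: its
value at `C'` is the determinant of the matrix of the weights of the atoms common to a layer of `C`
and a layer of `C'` (`IsBouquet.dualFun_eq_minor`), which expands to the entry of the chain matrix
at `(C, C')` (`IsBouquet.chainMatrix_apply`). The entry vanishes if the tops of the two chains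
differ, so the chain matrix is block diagonal, with one Gram matrix of neat chains for every maximal
element (`IsBouquet.det_chainMatrix`).

*Recursion.* In the neat basis the Gram matrix at `x` factors into those at the `y ⋖ x` with
`l x ≰ y` and the matrix of `T_x`, the sum of `ext ∘ cut` over the same `y`
(`IsBouquet.det_gram`, `IsBouquet.laplacian`).

*Spectrum.* The sum of `ext ∘ cut` over all `y ⋖ x` is the scalar `w(x)` (`sum_ext_cut`), and
between elements above `a` the operators `T` commute with `ext` (`IsBouquet.laplacian_comp_extHom`).
Since the trace is cyclic, this gives a recursion for the traces of the powers, which is solved by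
Möbius inversion and the formula `∑_{a ≤ y ≤ x} μ(⊥, y) = (-1)^{r(x)} β(x)`:
`tr T_x^j = ∑_{a ≤ v ≤ x} β(v) |μ(v, x)| w(v)^j` (`IsBouquet.trace_laplacian_pow`). For generic
weights the `w(v)` are distinct, so in characteristic zero they are the eigenvalues, with these
multiplicities. This gives the determinant of `T_x` and also `0 ≤ β`
(`IsBouquet.det_laplacian`, `IsBouquet.beta_nonneg`).

Finally `|μ(v, x)|` is the sum of `|μ(v, y)|` over the `y ⋖ x` with `a ≰ y`, for an atom `a ≤ x`,
`a ≰ v` (`IsBouquet.abs_mu_eq_sum`), so the recursion yields the exponent `β(v) |μ(v, x)|` of `w(v)`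
in the Gram determinant at `x` for all `v` (`IsBouquet.det_gram_eq_prod`).
-/

namespace Bouquet

/-! ### Covers, joins and weights in a bouquet -/

section Order

variable {P : Type*} [PartialOrder P]

/-- An element `t` that is not below `z` lies below at most one cover of `z`. -/
lemma IsBouquet.eq_of_covBy_of_covBy (hP : IsBouquet P) {z t y y' : P} (hzy : z ⋖ y)
    (hzy' : z ⋖ y') (hty : t ≤ y) (hty' : t ≤ y') (htz : ¬ t ≤ z) : y = y' := by
  obtain ⟨m, hm⟩ := hP.exists_meet y y'
  have hmy : m ≤ y := hm.1 (by simp)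
  have hmy' : m ≤ y' := hm.1 (by simp)
  have hzm : z ≤ m := hm.2 (by simp [lowerBounds, hzy.le, hzy'.le])
  have htm : t ≤ m := hm.2 (by simp [lowerBounds, hty, hty'])
  have hne : z < m := lt_of_le_of_ne hzm (by rintro rfl; exact htz htm)
  have h1 : m = y := by
    rcases hmy.lt_or_eq with h | h
    · exact absurd h (hzy.2 hne)
    · exact h
  have h2 : m = y' := by
    rcases hmy'.lt_or_eq with h | h
    · exact absurd h (hzy'.2 hne)
    · exact h
  exact h1.symm.trans h2

/-- Two distinct elements have at most one common cover. -/
lemma IsBouquet.cover_unique (hP : IsBouquet P) {z t y y' : P} (hzt : z ≠ t) (hzy : z ⋖ y)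
    (hzy' : z ⋖ y') (hty : t ⋖ y) (hty' : t ⋖ y') : y = y' := by
  refine hP.eq_of_covBy_of_covBy hzy hzy' hty.le hty'.le fun h => ?_
  exact hty.2 (lt_of_le_of_ne h hzt.symm) hzy.lt

lemma covBy_Icc_iff {u x : P} {a b : Set.Icc u x} : a ⋖ b ↔ (a : P) ⋖ b := by
  have := Set.OrdConnected.apply_covBy_apply_iff (OrderEmbedding.subtype (· ∈ Set.Icc u x))
    (a := a) (b := b)
    (by
      have h : Set.range (OrderEmbedding.subtype (· ∈ Set.Icc u x)) = Set.Icc u x :=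
        Subtype.range_coe
      rw [h]
      exact Set.ordConnected_Icc)
  exact this.symm

/-- A join computed in an interval is a join in the whole bouquet. -/
lemma IsBouquet.isLUB_of_isLUB_Icc (hP : IsBouquet P) {u x : P} {S : Set (Set.Icc u x)}
    {j : Set.Icc u x} (hS : S.Nonempty) (hj : IsLUB S j) {t : P}
    (ht : ∀ a ∈ S, (a : P) ≤ t) : (j : P) ≤ t := by
  obtain ⟨m, hm⟩ := hP.exists_meet j t
  have hmj : m ≤ j := hm.1 (by simp)
  have hmt : m ≤ t := hm.1 (by simp)
  have key : ∀ a ∈ S, (a : P) ≤ m := fun a ha =>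
    hm.2 (by simpa [lowerBounds] using ⟨hj.1 ha, ht a ha⟩)
  obtain ⟨a₀, ha₀⟩ := hS
  have hmem : m ∈ Set.Icc u x := ⟨a₀.2.1.trans (key a₀ ha₀), hmj.trans j.2.2⟩
  have : j ≤ ⟨m, hmem⟩ := hj.2 fun a ha => key a ha
  exact (show (j : P) ≤ m from this).trans hmt

lemma IsBouquet.exists_join (hP : IsBouquet P) {a b x : P} (hax : a ≤ x) (hbx : b ≤ x)
    {u : P} (hua : u ≤ a) (hub : u ≤ b) : ∃ j ≤ x, IsLUB {a, b} j := by
  obtain ⟨j, hj⟩ := (hP.interval u x (hua.trans hax)).exists_join ⟨a, hua, hax⟩ ⟨b, hub, hbx⟩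
  refine ⟨j, j.2.2, ?_, ?_⟩
  · rintro c (rfl | rfl)
    · exact hj.1 (Set.mem_insert _ _)
    · exact hj.1 (Set.mem_insert_of_mem _ rfl)
  · intro t ht
    refine hP.isLUB_of_isLUB_Icc ⟨_, Set.mem_insert _ _⟩ hj ?_
    rintro c (rfl | rfl)
    · exact ht (by simp)
    · exact ht (by simp)

/-- Semimodularity below a bound `x`, in the bouquet itself. -/
lemma IsBouquet.semimodular (hP : IsBouquet P) {m a b x : P} (hm : IsGLB {a, b} m)
    (hma : m ⋖ a) (hax : a ≤ x) (hbx : b ≤ x) : ∃ j ≤ x, IsLUB {a, b} j ∧ b ⋖ j := by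
  have hmb : m ≤ b := hm.1 (by simp)
  have hmx : m ≤ x := hmb.trans hbx
  obtain ⟨j, hjx, hj⟩ := hP.exists_join hax hbx hma.le hmb
  refine ⟨j, hjx, hj, ?_⟩
  have haj : a ≤ j := hj.1 (by simp)
  have hbj : b ≤ j := hj.1 (by simp)
  have := (hP.interval m x hmx).semimodular ⟨a, hma.le, hax⟩ ⟨b, hmb, hbx⟩ ⟨m, le_rfl, hmx⟩
    ⟨j, hma.le.trans haj, hjx⟩ ⟨?_, ?_⟩ ⟨?_, ?_⟩ (covBy_Icc_iff.2 hma)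
  · exact covBy_Icc_iff.1 this
  · rintro c (rfl | rfl)
    · exact hma.le
    · exact hmb
  · intro c hc
    exact hm.2 (by
      rintro d (rfl | rfl)
      · exact hc (Set.mem_insert _ _)
      · exact hc (Set.mem_insert_of_mem _ rfl))
  · rintro c (rfl | rfl)
    · exact haj
    · exact hbj
  · intro c hc
    exact hj.2 (by
      rintro d (rfl | rfl)
      · exact hc (Set.mem_insert _ _)
      · exact hc (Set.mem_insert_of_mem _ rfl))

/-- Birkhoff's covering condition: two distinct covers of `z` below `x` have a common cover
below `x`. -/
lemma IsBouquet.diamond (hP : IsBouquet P) {z a b x : P} (hza : z ⋖ a) (hzb : z ⋖ b)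
    (hab : a ≠ b) (hax : a ≤ x) (hbx : b ≤ x) : ∃ j ≤ x, a ⋖ j ∧ b ⋖ j := by
  have hglb : ∀ {a b : P}, z ⋖ a → z ⋖ b → a ≠ b → IsGLB {a, b} z := by
    intro a b hza hzb hab
    obtain ⟨m, hm⟩ := hP.exists_meet a b
    have hzm : z ≤ m := hm.2 (by simp [lowerBounds, hza.le, hzb.le])
    rcases hzm.eq_or_lt with rfl | h
    · exact hm
    · have hma : m ≤ a := hm.1 (by simp)
      have hmb : m ≤ b := hm.1 (by simp)
      exact absurd (hP.eq_of_covBy_of_covBy hza hzb hma hmb h.not_ge) hab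
  obtain ⟨j, hjx, hj, hbj⟩ := hP.semimodular (hglb hza hzb hab) hza hax hbx
  obtain ⟨j', _, hj', haj⟩ := hP.semimodular (hglb hzb hza hab.symm) hzb hbx hax
  rw [Set.pair_comm] at hj'
  obtain rfl := hj.unique hj'
  exact ⟨j, hjx, haj, hbj⟩

/-- In an interval of length two every element strictly between the ends is a cover of the lower
end and is covered by the upper end. -/
lemma IsBouquet.covBy_of_covBy_le (hP : IsBouquet P) {z y₀ y x : P} (h₁ : z ⋖ y₀) (h₂ : y₀ ⋖ x)
    (hzy : z ⋖ y) (hyx : y ≤ x) : y ⋖ x := by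
  rcases eq_or_ne y y₀ with rfl | hne
  · exact h₂
  · obtain ⟨j, hjx, hyj, hy₀j⟩ := hP.diamond hzy h₁ hne hyx h₂.le
    rcases hjx.eq_or_lt with rfl | h
    · exact hyj
    · exact absurd h (h₂.2 hy₀j.lt)

/-- Let `y` be covered by `x`, and let `s ⋖ t ⋖ y` and `s ⋖ z ≤ x`. Unless `z ⋖ y`, the covers `t`
and `z` of `s` have exactly one common cover, and `x` covers it. -/
lemma IsBouquet.existsUnique_cover (hP : IsBouquet P) {s t x y z : P} (hyx : y ⋖ x) (hzx : z ≤ x)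
    (hzy : ¬ z ⋖ y) (hty : t ⋖ y) (hst : s ⋖ t) (hsz : s ⋖ z) :
    ∃! y', z ⋖ y' ∧ t ⋖ y' ∧ y' ⋖ x := by
  have hzt : z ≠ t := by rintro rfl; exact hzy hty
  obtain ⟨j, hjx, hzj, htj⟩ := hP.diamond hsz hst hzt hzx (hty.le.trans hyx.le)
  exact ⟨j, ⟨hzj, htj, hP.covBy_of_covBy_le hty hyx htj hjx⟩,
    fun y' hy' => hP.cover_unique hzt hy'.1 hzj hy'.2.1 htj⟩

/-- If `y ⋖ x` and `a ≤ x`, `a ≰ y`, then `x` is the join of `y` and `a`. -/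
lemma IsBouquet.le_of_covBy (hP : IsBouquet P) {y x a t : P} (hyx : y ⋖ x) (hyt : y ≤ t)
    (hax : a ≤ x) (hay : ¬ a ≤ y) (hat : a ≤ t) : x ≤ t := by
  obtain ⟨m, hm⟩ := hP.exists_meet x t
  have hmx : m ≤ x := hm.1 (by simp)
  have hmt : m ≤ t := hm.1 (by simp)
  have hym : y ≤ m := hm.2 (by simp [lowerBounds, hyx.le, hyt])
  have ham : a ≤ m := hm.2 (by simp [lowerBounds, hax, hat])
  rcases hmx.eq_or_lt with rfl | hlt
  · exact hmt
  · exact absurd hlt (hyx.2 (lt_of_le_of_ne hym (by rintro rfl; exact hay ham)))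

variable [OrderBot P]

/-- Joining an atom `a` to an element `z` not above it gives a cover of `z`. -/
lemma IsBouquet.exists_covBy_atom (hP : IsBouquet P) {a z x : P} (ha : IsAtom a) (hax : a ≤ x)
    (hzx : z ≤ x) (haz : ¬ a ≤ z) : ∃ j ≤ x, IsLUB {a, z} j ∧ z ⋖ j := by
  refine hP.semimodular (m := ⊥) ⟨by simp [lowerBounds], ?_⟩ (bot_covBy_iff.2 ha) hax hzx
  intro c hc
  have hca : c ≤ a := hc (by simp)
  have hcz : c ≤ z := hc (by simp)
  rcases ha.le_iff.1 hca with rfl | rfl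
  · exact le_rfl
  · exact absurd hcz haz

/-- An element is determined by the atoms below it. -/
lemma IsBouquet.le_of_atoms_le (hP : IsBouquet P) {x y : P}
    (h : ∀ a, IsAtom a → a ≤ x → a ≤ y) : x ≤ y := by
  have hat := (hP.interval ⊥ x bot_le).atomic ⟨x, bot_le, le_rfl⟩
  rcases Set.eq_empty_or_nonempty {a : Set.Icc ⊥ x | (∃ b, IsBot b ∧ b ⋖ a) ∧
    a ≤ (⟨x, bot_le, le_rfl⟩ : Set.Icc ⊥ x)} with hS | hS
  · rw [hS] at hat
    have : (⟨x, bot_le, le_rfl⟩ : Set.Icc ⊥ x) ≤ ⟨⊥, le_rfl, bot_le⟩ := hat.2 (by simp)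
    exact le_trans (show x ≤ ⊥ from this) bot_le
  · refine hP.isLUB_of_isLUB_Icc hS hat ?_
    rintro a ⟨⟨b, hb, hba⟩, hax⟩
    have hb' : (b : P) = ⊥ := le_antisymm (hb ⟨⊥, le_rfl, bot_le⟩) bot_le
    refine h a ?_ hax
    have hcov := covBy_Icc_iff.1 hba
    rw [hb'] at hcov
    exact bot_covBy_iff.1 hcov

lemma IsBouquet.exists_atom (hP : IsBouquet P) {z x : P} (h : ¬ x ≤ z) :
    ∃ a, IsAtom a ∧ a ≤ x ∧ ¬ a ≤ z := by
  by_contra! hc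
  exact h (hP.le_of_atoms_le hc)

lemma IsBouquet.exists_labeling (hP : IsBouquet P) : ∃ l : P → P, IsLabeling l := by
  have : ∀ x : P, ∃ a, x ≠ ⊥ → IsAtom a ∧ a ≤ x := by
    intro x
    by_cases hx : x = ⊥
    · exact ⟨⊥, fun h => absurd hx h⟩
    · obtain ⟨a, ha, hax, _⟩ := hP.exists_atom (z := ⊥) (x := x) (by simpa using hx)
      exact ⟨a, fun _ => ⟨ha, hax⟩⟩
  choose l hl using this
  exact ⟨l, hl⟩

lemma IsBouquet.exists_joinFun (hP : IsBouquet P) {a x : P} (hax : a ≤ x) :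
    ∃ j : P → P, ∀ y ≤ x, j y ≤ x ∧ IsLUB {a, y} (j y) := by
  have : ∀ y : P, ∃ j, y ≤ x → j ≤ x ∧ IsLUB {a, y} j := by
    intro y
    by_cases hy : y ≤ x
    · obtain ⟨j, hjx, hj⟩ := hP.exists_join hax hy bot_le bot_le
      exact ⟨j, fun _ => ⟨hjx, hj⟩⟩
    · exact ⟨y, fun h => absurd h hy⟩
  choose j hj using this
  exact ⟨j, hj⟩

variable [Fintype P] {R : Type*} [CommRing R]

open Classical in
/-- The weight `∑_{a ≤ x} ω a` of `x`, for arbitrary atom weights `ω` in a commutative ring. For the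
variables `ω = X` this is `weight`; the weights concentrated at one atom are needed as well. -/
noncomputable def wt (ω : Atom P → R) (x : P) : R := ∑ a : Atom P with a.1 ≤ x, ω a

open Classical in
lemma wt_sub_wt (ω : Atom P → R) {z y : P} (h : z ≤ y) :
    wt ω y - wt ω z = ∑ a : Atom P with a.1 ≤ y ∧ ¬ a.1 ≤ z, ω a := by
  rw [sub_eq_iff_eq_add, wt, wt, add_comm,
    ← Finset.sum_filter_add_sum_filter_not _ (fun a : Atom P => a.1 ≤ z), Finset.filter_filter,
    Finset.filter_filter]
  congr 2
  ext a
  simp only [Finset.mem_filter, Finset.mem_univ, true_and]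
  exact ⟨fun ha => ha.2, fun ha => ⟨ha.trans h, ha⟩⟩

open Classical in
/-- The weight is additive over the covers of `z` below `x`, because every atom below `x` but not
below `z` lies below exactly one of them. -/
lemma IsBouquet.sum_wt_sub (hP : IsBouquet P) (ω : Atom P → R) {z x : P} (hzx : z ≤ x) :
    ∑ y : P with z ⋖ y ∧ y ≤ x, (wt ω y - wt ω z) = wt ω x - wt ω z := by
  rw [wt_sub_wt ω hzx, Finset.sum_congr rfl fun y hy => wt_sub_wt ω (Finset.mem_filter.1 hy).2.1.le,
    ← Finset.sum_biUnion]
  · congr 1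
    ext a
    simp only [Finset.mem_biUnion, Finset.mem_filter, Finset.mem_univ, true_and]
    constructor
    · rintro ⟨y, ⟨_, hyx⟩, hay, haz⟩
      exact ⟨hay.trans hyx, haz⟩
    · rintro ⟨hax, haz⟩
      obtain ⟨j, hjx, hj, hzj⟩ := hP.exists_covBy_atom a.2 hax hzx haz
      exact ⟨j, ⟨hzj, hjx⟩, hj.1 (by simp), haz⟩
  · intro y hy y' hy' hne
    simp only [Finset.coe_filter, Finset.mem_univ, true_and, Set.mem_ofPred_eq] at hy hy'
    rw [Function.onFun, Finset.disjoint_left]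
    intro a ha ha'
    simp only [Finset.mem_filter, Finset.mem_univ, true_and] at ha ha'
    exact hne (hP.eq_of_covBy_of_covBy hy.1 hy'.1 ha.1 ha'.1 ha.2)

open Classical in
lemma IsBouquet.sum_wt_sub_covBy (hP : IsBouquet P) (ω : Atom P → R) {z y₀ x : P} (h₁ : z ⋖ y₀)
    (h₂ : y₀ ⋖ x) : ∑ y : P with z ⋖ y ∧ y ⋖ x, (wt ω y - wt ω z) = wt ω x - wt ω z := by
  rw [← hP.sum_wt_sub ω (h₁.le.trans h₂.le)]
  congr 1
  ext y
  simp only [Finset.mem_filter, Finset.mem_univ, true_and]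
  exact ⟨fun h => ⟨h.1, h.2.le⟩, fun h => ⟨h.1, hP.covBy_of_covBy_le h₁ h₂ h.1 h.2⟩⟩

@[simp]
lemma wt_bot (ω : Atom P → R) : wt ω ⊥ = 0 := by
  classical
  refine Finset.sum_eq_zero fun a ha => ?_
  simp only [Finset.mem_filter, le_bot_iff] at ha
  exact absurd ha.2 a.2.1

end Order

/-! ### Flag functions -/

section FlagFunctions

variable {P : Type*} {R : Type*} [CommRing R]

/-- Restriction of a function on descending chains to the chains that begin with `y`, viewed as a
function of the rest of the chain. -/
def cut (y : P) : (List P → R) →ₗ[R] (List P → R) := LinearMap.funLeft R R (List.cons y)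

@[simp]
lemma cut_apply (y : P) (f : List P → R) (C : List P) : cut y f C = f (y :: C) := rfl

lemma eq_of_cut_eq {f g : List P → R} (h₀ : f [] = g []) (h : ∀ y, cut y f = cut y g) : f = g := by
  funext C
  cases C with
  | nil => exact h₀
  | cons y C => exact congrFun (h y) C

variable [PartialOrder P] [Fintype P]

open Classical in
/-- The value of `ext w x y f` at the chain `C`, as a linear functional of `f`. The recursion says
that restriction is an antiderivation with respect to multiplication: restricting
`ext w x y f` to `y` gives `(w x - w y) f`, and restricting it to another element `y'` gives
minus the product of the restrictions of `f`. -/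
noncomputable def extAt (w : P → R) : List P → P → P → (List P → R) →ₗ[R] R
  | [], _, _ => 0
  | y' :: C, x, y =>
    if y' ⋖ x ∧ y ⋖ x then
      if y' = y then (w x - w y) • LinearMap.proj C
      else -∑ z : P with z ⋖ y ∧ z ⋖ y', extAt w C y' z ∘ₗ cut z
    else 0

/-- The component `A_y → A_x`, for `y ⋖ x`, of the multiplication by the weighted sum of all
atoms in the Orlik–Solomon algebra, written in terms of functions on chains. -/
noncomputable def ext (w : P → R) (x y : P) : (List P → R) →ₗ[R] (List P → R) :=
  LinearMap.pi fun C => extAt w C x y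

@[simp]
lemma ext_nil (w : P → R) (x y : P) (f : List P → R) : ext w x y f [] = 0 := rfl

lemma ext_of_not_covBy (w : P → R) {x y : P} (h : ¬ y ⋖ x) : ext w x y = 0 := by
  ext f C
  cases C with
  | nil => rfl
  | cons y' C => simp [ext, extAt, h]

lemma cut_ext_of_not_covBy (w : P → R) {x y' : P} (h : ¬ y' ⋖ x) (y : P) (f : List P → R) :
    cut y' (ext w x y f) = 0 := by
  funext C
  simp [ext, extAt, h]

lemma cut_ext_self (w : P → R) {x y : P} (h : y ⋖ x) (f : List P → R) :
    cut y (ext w x y f) = (w x - w y) • f := by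
  funext C
  simp [ext, extAt, h]

open Classical in
lemma cut_ext_of_ne (w : P → R) {x y y' : P} (h : y ⋖ x) (h' : y' ⋖ x) (hne : y' ≠ y)
    (f : List P → R) :
    cut y' (ext w x y f) = -∑ z : P with z ⋖ y ∧ z ⋖ y', ext w y' z (cut z f) := by
  funext C
  simp [ext, extAt, h, h', hne, LinearMap.sum_apply]

variable {x y z : P}

/-- If all elements below `x` have weight zero, then `ext` vanishes. -/
lemma ext_eq_zero {w : P → R} (h : ∀ u ≤ x, w u = 0) (y : P) : ext w x y = 0 := by
  induction x using WellFoundedLT.induction generalizing y with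
  | ind x ih =>
    by_cases hyx : y ⋖ x
    swap
    · exact ext_of_not_covBy _ hyx
    refine LinearMap.ext fun f => eq_of_cut_eq rfl fun y' => ?_
    rw [LinearMap.zero_apply, map_zero]
    by_cases hy' : y' ⋖ x
    swap
    · exact cut_ext_of_not_covBy _ hy' _ _
    rcases eq_or_ne y' y with rfl | hne
    · rw [cut_ext_self _ hyx, h x le_rfl, h y' hyx.le, sub_zero, zero_smul]
    · classical
      rw [cut_ext_of_ne _ hyx hy' hne, neg_eq_zero]
      refine Finset.sum_eq_zero fun z _ => ?_
      rw [ih y' hy'.lt (fun u hu => h u (hu.trans hy'.le)), LinearMap.zero_apply]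

open Classical in
/-- Reordering of a sum over the diamonds `s ⋖ t, z ⋖ y'`, where `t ⋖ y ⋖ x` and `y' ⋖ x`: the top
`y'` is determined by the rest of the diamond. -/
lemma IsBouquet.sum_diamond (hP : IsBouquet P) {M : Type*} [AddCommGroup M] (hyx : y ⋖ x)
    (hzx : z ≤ x) (hzy : ¬ z ⋖ y) (F : P → P → M) :
    ∑ y' : P with z ⋖ y' ∧ y' ⋖ x, ∑ t : P with t ⋖ y ∧ t ⋖ y', ∑ s : P with s ⋖ t ∧ s ⋖ z, F s t =
    ∑ s : P with s ⋖ z, ∑ t : P with s ⋖ t ∧ t ⋖ y, F s t := by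
  have h1 : ∀ y', ∑ t : P with t ⋖ y ∧ t ⋖ y', ∑ s : P with s ⋖ t ∧ s ⋖ z, F s t =
      ∑ s : P with s ⋖ z, ∑ t : P with s ⋖ t ∧ t ⋖ y, if t ⋖ y' then F s t else 0 := by
    intro y'
    simp only [← Finset.sum_filter]
    refine Finset.sum_comm' fun t s => ?_
    simp only [Finset.mem_filter, Finset.mem_univ, true_and]
    tauto
  rw [Finset.sum_congr rfl fun y' _ => h1 y', Finset.sum_comm]
  refine Finset.sum_congr rfl fun s hs => ?_
  rw [Finset.sum_comm]
  refine Finset.sum_congr rfl fun t ht => ?_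
  simp only [Finset.mem_filter, Finset.mem_univ, true_and] at hs ht
  obtain ⟨j, hj, hju⟩ := hP.existsUnique_cover hyx hzx hzy ht.2 ht.1 hs
  rw [Finset.sum_eq_single j]
  · rw [if_pos hj.2.1]
  · intro y' hy' hne
    simp only [Finset.mem_filter, Finset.mem_univ, true_and] at hy'
    exact if_neg fun h => hne (hju y' ⟨hy'.1, h, hy'.2⟩)
  · intro h
    exact absurd (by simpa using ⟨hj.1, hj.2.2⟩) h

variable [OrderBot P]

open Classical in
/-- The functions on the saturated chains from `x` down to `⊥` (written without `x`, from the top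
to the bottom) that satisfy the exchange relations: if an
element other than `x` and `⊥` is removed from a chain, the sum over all ways to fill the gap
vanishes. For a geometric lattice this is the component at `x` of the Orlik–Solomon algebra, an
element of which is given by its iterated residues along the chains. -/
inductive IsFlagFun : P → (List P → R) → Prop
  | mk {x : P} {f : List P → R} (nil : x ≠ ⊥ → f [] = 0)
      (support : ∀ y, ¬ y ⋖ x → cut y f = 0)
      (cut_mem : ∀ y, y ⋖ x → IsFlagFun y (cut y f))
      (exchange : ∀ z, ∑ y : P with z ⋖ y ∧ y ⋖ x, cut z (cut y f) = 0) : IsFlagFun x f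

variable {f g : List P → R}

lemma IsFlagFun.nil (h : IsFlagFun x f) : x ≠ ⊥ → f [] = 0 := by
  cases h; assumption

lemma IsFlagFun.support (h : IsFlagFun x f) : ¬ y ⋖ x → cut y f = 0 := by
  cases h with | mk _ h _ _ => exact h y

lemma IsFlagFun.cut_mem (h : IsFlagFun x f) : y ⋖ x → IsFlagFun y (cut y f) := by
  cases h with | mk _ _ h _ => exact h y

open Classical in
lemma IsFlagFun.exchange (h : IsFlagFun x f) (z : P) :
    ∑ y : P with z ⋖ y ∧ y ⋖ x, cut z (cut y f) = 0 := by
  cases h with | mk _ _ _ h => exact h z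

lemma isFlagFun_zero (x : P) : IsFlagFun x (0 : List P → R) := by
  induction x using WellFoundedLT.induction with
  | ind x ih =>
    exact ⟨fun _ => rfl, fun _ _ => map_zero _, fun y hy => by simpa using ih y hy.lt,
      fun z => by simp⟩

lemma IsFlagFun.add (hf : IsFlagFun x f) (hg : IsFlagFun x g) : IsFlagFun x (f + g) := by
  induction x using WellFoundedLT.induction generalizing f g with
  | ind x ih =>
    refine ⟨fun hx => by simp [hf.nil hx, hg.nil hx],
      fun y hy => by rw [map_add, hf.support hy, hg.support hy, add_zero], fun y hy => ?_,
      fun z => ?_⟩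
    · rw [map_add]
      exact ih y hy.lt (hf.cut_mem hy) (hg.cut_mem hy)
    · simp only [map_add, Finset.sum_add_distrib, hf.exchange, hg.exchange, add_zero]

lemma IsFlagFun.smul (c : R) (hf : IsFlagFun x f) : IsFlagFun x (c • f) := by
  induction x using WellFoundedLT.induction generalizing f with
  | ind x ih =>
    refine ⟨fun hx => by simp [hf.nil hx], fun y hy => by rw [map_smul, hf.support hy, smul_zero],
      fun y hy => ?_, fun z => ?_⟩
    · rw [map_smul]
      exact ih y hy.lt (hf.cut_mem hy)
    · simp only [map_smul, ← Finset.smul_sum, hf.exchange, smul_zero]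

variable (R) in
/-- The module of flag functions at `x`; see `IsFlagFun`. -/
def flagModule (x : P) : Submodule R (List P → R) where
  carrier := {f | IsFlagFun x f}
  add_mem' := IsFlagFun.add
  zero_mem' := isFlagFun_zero x
  smul_mem' c _ := IsFlagFun.smul c

lemma cut_mem_flagModule (y : P) (hf : f ∈ flagModule R x) : cut y f ∈ flagModule R y := by
  by_cases h : y ⋖ x
  · exact hf.cut_mem h
  · rw [hf.support h]
    exact zero_mem _

open Classical in
/-- Restriction followed by multiplication, `∑_y ext x y ∘ cut y`, is the scalar `w(x)`. -/
lemma sum_ext_cut (ω : Atom P → R) (hf : f ∈ flagModule R x) :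
    ∑ y : P with y ⋖ x, ext (wt ω) x y (cut y f) = wt ω x • f := by
  induction x using WellFoundedLT.induction generalizing f with
  | ind x ih =>
    refine eq_of_cut_eq ?_ fun y' => ?_
    · rcases eq_or_ne x ⊥ with rfl | hx
      · simp
      · simp [hf.nil hx]
    by_cases hy' : y' ⋖ x
    swap
    · simp [cut_ext_of_not_covBy _ hy', hf.support hy']
    rw [map_sum, ← Finset.add_sum_erase _ _ (show y' ∈ _ by simpa using hy'), cut_ext_self _ hy',
      Finset.sum_congr rfl fun y hy => cut_ext_of_ne _ (by simp at hy; exact hy.2) hy'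
        (by simp at hy; exact fun h => hy.1 h.symm) _]
    have hswap : ∑ y ∈ (Finset.univ.filter (· ⋖ x)).erase y',
        ∑ z : P with z ⋖ y ∧ z ⋖ y', ext (wt ω) y' z (cut z (cut y f)) =
        ∑ z : P with z ⋖ y', ext (wt ω) y' z
          (∑ y ∈ (Finset.univ.filter fun y => z ⋖ y ∧ y ⋖ x).erase y', cut z (cut y f)) := by
      simp only [map_sum]
      refine Finset.sum_comm' fun y z => ?_
      simp only [Finset.mem_erase, Finset.mem_filter, Finset.mem_univ, true_and]
      tauto
    -- By the exchange relation, the restrictions through the other `y` add up to minus the one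
    -- through `y'`; this reduces the claim at `x` to the claim at `y'`.
    have hin : ∀ z ∈ Finset.univ.filter (· ⋖ y'),
        ∑ y ∈ (Finset.univ.filter fun y => z ⋖ y ∧ y ⋖ x).erase y', cut z (cut y f) =
          -cut z (cut y' f) := by
      intro z hz
      have hz' : z ⋖ y' := by simpa using hz
      rw [eq_neg_iff_add_eq_zero, add_comm,
        Finset.add_sum_erase (Finset.univ.filter fun y => z ⋖ y ∧ y ⋖ x)
          (fun y => cut z (cut y f)) (by simpa using ⟨hz', hy'⟩)]
      exact hf.exchange z
    rw [Finset.sum_neg_distrib, hswap, Finset.sum_congr rfl fun z hz => by rw [hin z hz]]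
    simp only [map_neg, Finset.sum_neg_distrib, neg_neg]
    rw [ih y' hy'.lt (hf.cut_mem hy'), ← add_smul, sub_add_cancel, map_smul]

open Classical in
/-- Multiplication by a weighted sum of atoms preserves the exchange relations. -/
lemma IsBouquet.ext_mem (hP : IsBouquet P) (ω : Atom P → R) (x : P) (hf : f ∈ flagModule R y) :
    ext (wt ω) x y f ∈ flagModule R x := by
  by_cases hyx : y ⋖ x
  swap
  · rw [ext_of_not_covBy _ hyx]
    exact zero_mem _
  induction x using WellFoundedLT.induction generalizing y f with
  | ind x ih =>
    refine ⟨fun _ => rfl, fun y' hy' => cut_ext_of_not_covBy _ hy' _ _, fun y' hy' => ?_,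
      fun z => ?_⟩
    · rcases eq_or_ne y' y with rfl | hne
      · rw [cut_ext_self _ hyx]
        exact hf.smul _
      · rw [cut_ext_of_ne _ hyx hy' hne]
        refine (flagModule R y').neg_mem ((flagModule R y').sum_mem fun z hz => ?_)
        simp only [Finset.mem_filter, Finset.mem_univ, true_and] at hz
        exact ih y' hy'.lt (hf.cut_mem hz.1) hz.2
    -- The exchange relation at `z`: if `z ⋖ y`, it is the additivity of the weights over the covers
    -- of `z`; otherwise it follows from the exchange relation of `f`, through diamonds.
    · by_cases hzy : z ⋖ y
      · rw [← Finset.add_sum_erase _ _ (show y ∈ _ by simpa using ⟨hzy, hyx⟩), cut_ext_self _ hyx]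
        have h2 : ∀ y' ∈ (Finset.univ.filter fun y' => z ⋖ y' ∧ y' ⋖ x).erase y,
            cut z (cut y' (ext (wt ω) x y f)) = -((wt ω y' - wt ω z) • cut z f) := by
          intro y' hy'
          simp only [Finset.mem_erase, Finset.mem_filter, Finset.mem_univ, true_and] at hy'
          obtain ⟨hne, hzy', hy'x⟩ := hy'
          rw [cut_ext_of_ne _ hyx hy'x hne, Finset.sum_eq_single z, map_neg, cut_ext_self _ hzy']
          · intro t ht htz
            simp only [Finset.mem_filter, Finset.mem_univ, true_and] at ht
            exact absurd (hP.cover_unique htz ht.1 ht.2 hzy hzy').symm hne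
          · intro h
            exact absurd (by simpa using ⟨hzy, hzy'⟩) h
        rw [Finset.sum_congr rfl h2, Finset.sum_neg_distrib, ← Finset.sum_smul, map_smul]
        have := hP.sum_wt_sub_covBy ω hzy hyx
        rw [← Finset.add_sum_erase _ _ (show y ∈ Finset.univ.filter (fun y' => z ⋖ y' ∧ y' ⋖ x) by
            simpa using ⟨hzy, hyx⟩)] at this
        rw [← sub_eq_add_neg, ← sub_smul]
        convert zero_smul R _
        linear_combination -this
      · by_cases hzx : z ≤ x
        swap
        · refine Finset.sum_eq_zero fun y' hy' => ?_
          simp only [Finset.mem_filter, Finset.mem_univ, true_and] at hy'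
          exact absurd (hy'.1.le.trans hy'.2.le) hzx
        have h2 : ∀ y' ∈ Finset.univ.filter fun y' => z ⋖ y' ∧ y' ⋖ x,
            cut z (cut y' (ext (wt ω) x y f)) = ∑ t : P with t ⋖ y ∧ t ⋖ y',
              ∑ s : P with s ⋖ t ∧ s ⋖ z, ext (wt ω) z s (cut s (cut t f)) := by
          intro y' hy'
          simp only [Finset.mem_filter, Finset.mem_univ, true_and] at hy'
          rw [cut_ext_of_ne _ hyx hy'.2 (by rintro rfl; exact hzy hy'.1), map_neg, map_sum,
            ← Finset.sum_neg_distrib]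
          refine Finset.sum_congr rfl fun t ht => ?_
          simp only [Finset.mem_filter, Finset.mem_univ, true_and] at ht
          rw [cut_ext_of_ne _ ht.2 hy'.1 (by rintro rfl; exact hzy ht.1), neg_neg]
        rw [Finset.sum_congr rfl h2, hP.sum_diamond hyx hzx hzy]
        refine Finset.sum_eq_zero fun s _ => ?_
        rw [← map_sum, hf.exchange s, map_zero]

open Classical in
/-- The multiplication by the weighted sum of all atoms squares to zero. -/
lemma IsBouquet.sum_ext_ext (hP : IsBouquet P) (ω : Atom P → R) (x : P) {v : P}
    (hf : f ∈ flagModule R v) :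
    ∑ y : P with v ⋖ y ∧ y ⋖ x, ext (wt ω) x y (ext (wt ω) y v f) = 0 := by
  induction x using WellFoundedLT.induction generalizing v f with
  | ind x ih =>
    refine eq_of_cut_eq (by simp) fun z => ?_
    rw [map_sum, map_zero]
    by_cases hzx : z ⋖ x
    swap
    · exact Finset.sum_eq_zero fun y _ => cut_ext_of_not_covBy _ hzx _ _
    -- If `v ⋖ z`, this is the additivity of the weights over the covers of `v`; otherwise it is
    -- the claim at `z` for the restrictions of `f`.
    by_cases hvz : v ⋖ z
    · rw [← Finset.add_sum_erase _ _ (show z ∈ _ by simpa using ⟨hvz, hzx⟩), cut_ext_self _ hzx]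
      have h2 : ∀ y ∈ (Finset.univ.filter fun y => v ⋖ y ∧ y ⋖ x).erase z,
          cut z (ext (wt ω) x y (ext (wt ω) y v f)) =
            -((wt ω y - wt ω v) • ext (wt ω) z v f) := by
        intro y hy
        simp only [Finset.mem_erase, Finset.mem_filter, Finset.mem_univ, true_and] at hy
        obtain ⟨hne, hvy, hyx⟩ := hy
        rw [cut_ext_of_ne _ hyx hzx hne.symm, Finset.sum_eq_single v, cut_ext_self _ hvy, map_smul]
        · intro t ht htv
          simp only [Finset.mem_filter, Finset.mem_univ, true_and] at ht
          exact absurd (hP.cover_unique htv ht.1 ht.2 hvy hvz) hne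
        · intro h
          exact absurd (by simpa using ⟨hvy, hvz⟩) h
      rw [Finset.sum_congr rfl h2, Finset.sum_neg_distrib, ← Finset.sum_smul]
      have := hP.sum_wt_sub_covBy ω hvz hzx
      rw [← Finset.add_sum_erase _ _ (show z ∈ Finset.univ.filter (fun y => v ⋖ y ∧ y ⋖ x) by
            simpa using ⟨hvz, hzx⟩)] at this
      rw [← sub_eq_add_neg, ← sub_smul]
      convert zero_smul R _
      linear_combination -this
    · by_cases hvx : v ≤ x
      swap
      · refine Finset.sum_eq_zero fun y hy => ?_
        simp only [Finset.mem_filter, Finset.mem_univ, true_and] at hy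
        exact absurd (hy.1.le.trans hy.2.le) hvx
      have h2 : ∀ y ∈ Finset.univ.filter fun y => v ⋖ y ∧ y ⋖ x,
          cut z (ext (wt ω) x y (ext (wt ω) y v f)) = ∑ t : P with t ⋖ z ∧ t ⋖ y,
            ∑ s : P with s ⋖ t ∧ s ⋖ v, ext (wt ω) z t (ext (wt ω) t s (cut s f)) := by
        intro y hy
        simp only [Finset.mem_filter, Finset.mem_univ, true_and] at hy
        rw [cut_ext_of_ne _ hy.2 hzx (by rintro rfl; exact hvz hy.1), ← Finset.sum_neg_distrib]
        simp only [and_comm (b := _ ⋖ y)]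
        refine Finset.sum_congr rfl fun t ht => ?_
        simp only [Finset.mem_filter, Finset.mem_univ, true_and] at ht
        rw [cut_ext_of_ne _ hy.1 ht.1 (by rintro rfl; exact hvz ht.2), map_neg, neg_neg, map_sum]
        simp only [and_comm (b := _ ⋖ t)]
      rw [Finset.sum_congr rfl h2, hP.sum_diamond hzx hvx hvz]
      refine Finset.sum_eq_zero fun s hs => ?_
      simp only [Finset.mem_filter, Finset.mem_univ, true_and] at hs
      exact ih z hzx.lt (hf.cut_mem hs)

/-- A flag function at `x` is determined by its restrictions to the elements covered by `x` that
do not lie above a fixed atom `a ≤ x`. -/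
lemma IsBouquet.eq_zero_of_cut_eq_zero (hP : IsBouquet P) {a : P} (ha : a ≠ ⊥) (hax : a ≤ x)
    (hf : f ∈ flagModule R x) (h : ∀ y, y ⋖ x → ¬ a ≤ y → cut y f = 0) : f = 0 := by
  classical
  induction x using WellFoundedLT.induction generalizing f with
  | ind x ih =>
    refine eq_of_cut_eq ?_ fun y => ?_
    · exact hf.nil (by rintro rfl; exact ha (le_bot_iff.1 hax))
    rw [map_zero]
    by_cases hyx : y ⋖ x
    swap
    · exact hf.support hyx
    by_cases hay : a ≤ y
    swap
    · exact h y hyx hay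
    refine ih y hyx.lt hay (hf.cut_mem hyx) fun z hzy haz => ?_
    rw [← hf.exchange z, Finset.sum_eq_single y]
    · intro y' hy' hne
      simp only [Finset.mem_filter, Finset.mem_univ, true_and] at hy'
      rw [h y' hy'.2, map_zero]
      exact fun hay' => hne (hP.eq_of_covBy_of_covBy hy'.1 hzy hay' hay haz)
    · intro h
      exact absurd (by simpa using ⟨hzy, hyx⟩) h

lemma wt_single_le {a : Atom P} [DecidableEq (Atom P)] (h : a.1 ≤ x) :
    wt (Pi.single a (1 : R)) x = 1 := by
  classical
  rw [wt, Finset.sum_pi_single', if_pos (by simpa using h)]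

lemma wt_single_not_le {a : Atom P} [DecidableEq (Atom P)] (h : ¬ a.1 ≤ x) :
    wt (Pi.single a (1 : R)) x = 0 := by
  classical
  rw [wt, Finset.sum_pi_single', if_neg (by simpa using h)]

open Classical in
/-- Multiplication by a single atom `a`, followed by restriction to an element not above `a`. -/
lemma cut_ext_single {a : Atom P} {y' : P} (hax : a.1 ≤ x) (hay' : ¬ a.1 ≤ y') (hyx : y ⋖ x)
    (f : List P → R) :
    cut y' (ext (wt (Pi.single a 1)) x y f) = if y' = y then f else 0 := by
  by_cases hy' : y' ⋖ x
  swap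
  · rw [cut_ext_of_not_covBy _ hy', if_neg (by rintro rfl; exact hy' hyx)]
  split_ifs with h
  · subst h
    rw [cut_ext_self _ hyx, wt_single_le hax, wt_single_not_le hay', sub_zero, one_smul]
  · rw [cut_ext_of_ne _ hyx hy' h, neg_eq_zero]
    refine Finset.sum_eq_zero fun z _ => ?_
    rw [ext_eq_zero, LinearMap.zero_apply]
    exact fun u hu => wt_single_not_le fun h => hay' (h.trans hu)

end FlagFunctions

/-! ### The basis given by the neat chains -/

section NeatBasis

variable {P : Type*} [PartialOrder P] [OrderBot P] {R : Type*} [CommRing R]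

/-- The neat saturated chains from `x` down to `⊥`, written from the top to the bottom and
without `x`. -/
def IsNeatBelow (l : P → P) : List P → P → Prop
  | [], x => x = ⊥
  | y :: C, x => y ⋖ x ∧ ¬ l x ≤ y ∧ IsNeatBelow l C y

/-- The type of neat saturated chains from `x` down to `⊥`; see `IsNeatBelow`. -/
abbrev NeatBelow (l : P → P) (x : P) : Type _ := {C : List P // IsNeatBelow l C x}

variable {l : P → P} {x : P}

lemma IsNeatBelow.exists_cons {C : List P} (hx : x ≠ ⊥) (h : IsNeatBelow l C x) :
    ∃ y D, C = y :: D ∧ y ⋖ x ∧ ¬ l x ≤ y ∧ IsNeatBelow l D y := by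
  cases C with
  | nil => exact absurd h hx
  | cons y D => exact ⟨y, D, rfl, h⟩

lemma isNeatBelow_bot_iff {C : List P} : IsNeatBelow l C ⊥ ↔ C = [] := by
  cases C with
  | nil => simp [IsNeatBelow]
  | cons y D => simp [IsNeatBelow, not_covBy_bot]

instance [Finite P] (x : P) : Finite (NeatBelow l x) := by
  have : ∀ x : P, {C : List P | IsNeatBelow l C x}.Finite := by
    intro x
    induction x using WellFoundedLT.induction with
    | ind x ih =>
      refine ((Set.toFinite {[]}).union
        ((Set.toFinite {y | y < x}).biUnion (t := fun y => List.cons y '' {C | IsNeatBelow l C y})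
          fun y hy => (ih y hy).image _)).subset ?_
      rintro (_ | ⟨y, C⟩) hC
      · exact Or.inl rfl
      · exact Or.inr (Set.mem_biUnion (x := y) hC.1.lt ⟨C, hC.2.2, rfl⟩)
  exact this x

noncomputable instance [Finite P] (x : P) : Fintype (NeatBelow l x) := Fintype.ofFinite _

/-- Neat chains to `x ≠ ⊥` split according to the element covered by `x`. -/
def neatBelowEquiv (l : P → P) (hx : x ≠ ⊥) :
    NeatBelow l x ≃ Σ y : {y : P // y ⋖ x ∧ ¬ l x ≤ y}, NeatBelow l y.1 where
  toFun
    | ⟨[], h⟩ => absurd h hx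
    | ⟨y :: C, h⟩ => ⟨⟨y, h.1, h.2.1⟩, ⟨C, h.2.2⟩⟩
  invFun p := ⟨p.1.1 :: p.2.1, p.1.2.1, p.1.2.2, p.2.2⟩
  left_inv := by
    rintro ⟨_ | ⟨y, C⟩, h⟩
    · exact absurd h hx
    · rfl
  right_inv := by rintro ⟨⟨y, hy⟩, ⟨C, hC⟩⟩; rfl

variable [Fintype P]

lemma card_neatBelow_bot (l : P → P) : Fintype.card (NeatBelow l ⊥) = 1 := by
  rw [Fintype.card_eq_one_iff]
  exact ⟨⟨[], rfl⟩, fun C => Subtype.ext (isNeatBelow_bot_iff.1 C.2)⟩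

open Classical in
lemma card_neatBelow (l : P → P) (hx : x ≠ ⊥) : Fintype.card (NeatBelow l x) =
    ∑ y : P with y ⋖ x ∧ ¬ l x ≤ y, Fintype.card (NeatBelow l y) := by
  rw [Fintype.card_congr (neatBelowEquiv l hx), Fintype.card_sigma]
  exact (Finset.sum_subtype _ (by simp) fun y => Fintype.card (NeatBelow l y)).symm

/-- A flag function is determined by its values at the neat chains. -/
lemma IsBouquet.eq_zero_of_neat (hP : IsBouquet P) (hl : IsLabeling l) {f : List P → R}
    (hf : f ∈ flagModule R x) (h : ∀ C, IsNeatBelow l C x → f C = 0) : f = 0 := by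
  induction x using WellFoundedLT.induction generalizing f with
  | ind x ih =>
    rcases eq_or_ne x ⊥ with rfl | hx
    · refine eq_of_cut_eq (h [] rfl) fun y => ?_
      rw [hf.support not_covBy_bot, map_zero]
    · refine hP.eq_zero_of_cut_eq_zero (hl x hx).1.1 (hl x hx).2 hf fun y hy hly => ?_
      exact ih y hy.lt (hf.cut_mem hy) fun C hC => h (y :: C) ⟨hy, hly, hC⟩

/-- Flag functions `g y` at the elements `y ⋖ x` not above the atom `a ≤ x` are the restrictions of
one flag function at `x`, the sum of the products of the `g y` by `a`. -/
lemma IsBouquet.exists_cut_eq (hP : IsBouquet P) {a : P} (ha : IsAtom a) (hax : a ≤ x)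
    (g : P → List P → R) (hg : ∀ y, y ⋖ x → ¬ a ≤ y → g y ∈ flagModule R y) :
    ∃ f ∈ flagModule R x, ∀ y, y ⋖ x → ¬ a ≤ y → cut y f = g y := by
  classical
  refine ⟨∑ y : P with y ⋖ x ∧ ¬ a ≤ y, ext (wt (Pi.single ⟨a, ha⟩ 1)) x y (g y),
    sum_mem fun y hy => ?_, fun y hyx hay => ?_⟩
  · simp only [Finset.mem_filter, Finset.mem_univ, true_and] at hy
    exact hP.ext_mem _ _ (hg y hy.1 hy.2)
  · rw [map_sum, Finset.sum_eq_single y]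
    · rw [cut_ext_single hax hay hyx, if_pos rfl]
    · intro y' hy' hne
      simp only [Finset.mem_filter, Finset.mem_univ, true_and] at hy'
      rw [cut_ext_single hax hay hy'.1, if_neg hne.symm]
    · intro h
      exact absurd (by simpa using ⟨hyx, hay⟩) h

lemma single_mem_flagModule_bot [DecidableEq (List P)] (c : R) :
    Pi.single [] c ∈ flagModule R (⊥ : P) := by
  classical
  refine ⟨fun h => absurd rfl h, fun y _ => ?_, fun y hy => absurd hy not_covBy_bot, fun z => ?_⟩
  · funext C
    simp
  · refine Finset.sum_eq_zero fun y hy => ?_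
    exact absurd (Finset.mem_filter.1 hy).2.2 not_covBy_bot

/-- A flag function may take arbitrary values at the neat chains. -/
lemma IsBouquet.exists_eq_on_neat (hP : IsBouquet P) (hl : IsLabeling l) (x : P)
    (h : List P → R) : ∃ f ∈ flagModule R x, ∀ C, IsNeatBelow l C x → f C = h C := by
  classical
  induction x using WellFoundedLT.induction generalizing h with
  | ind x ih =>
    rcases eq_or_ne x ⊥ with rfl | hx
    · refine ⟨Pi.single [] (h []), single_mem_flagModule_bot _, fun C hC => ?_⟩
      rw [isNeatBelow_bot_iff.1 hC, Pi.single_eq_same]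
    · have : ∀ y, ∃ g : List P → R, y ⋖ x →
          g ∈ flagModule R y ∧ ∀ C, IsNeatBelow l C y → g C = cut y h C := by
        intro y
        by_cases hy : y ⋖ x
        · obtain ⟨g, hg⟩ := ih y hy.lt (cut y h)
          exact ⟨g, fun _ => hg⟩
        · exact ⟨0, fun h => absurd h hy⟩
      choose g hg using this
      obtain ⟨f, hf, hfg⟩ := hP.exists_cut_eq (hl x hx).1 (hl x hx).2 g fun y hy _ => (hg y hy).1
      refine ⟨f, hf, fun C hC => ?_⟩
      obtain ⟨y, D, rfl, hyx, hly, hD⟩ := hC.exists_cons hx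
      rw [← cut_apply y f D, hfg y hyx hly, (hg y hyx).2 D hD, cut_apply]

variable (R) in
/-- Evaluation of flag functions at the neat chains. -/
def evalNeat (l : P → P) (x : P) : flagModule R x →ₗ[R] (NeatBelow l x → R) :=
  (LinearMap.funLeft R R Subtype.val).domRestrict _

lemma IsBouquet.evalNeat_bijective (hP : IsBouquet P) (hl : IsLabeling l) (x : P) :
    Function.Bijective (evalNeat R l x) := by
  constructor
  · rw [injective_iff_map_eq_zero]
    intro f hf
    exact Subtype.ext (hP.eq_zero_of_neat hl f.2 fun C hC => congrFun hf ⟨C, hC⟩)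
  · intro h
    classical
    obtain ⟨f, hf, hfh⟩ := hP.exists_eq_on_neat hl x
      (fun C => if hC : IsNeatBelow l C x then h ⟨C, hC⟩ else 0)
    refine ⟨⟨f, hf⟩, funext fun C => ?_⟩
    exact (hfh C.1 C.2).trans (dif_pos C.2)

variable (R) in
/-- The basis of the module of flag functions at `x` that is dual to the neat chains. -/
noncomputable def IsBouquet.neatBasis (hP : IsBouquet P) (hl : IsLabeling l) (x : P) :
    Module.Basis (NeatBelow l x) R (flagModule R x) :=
  Module.Basis.ofEquivFun (LinearEquiv.ofBijective (evalNeat R l x) (hP.evalNeat_bijective hl x))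

@[simp]
lemma IsBouquet.neatBasis_repr (hP : IsBouquet P) (hl : IsLabeling l) (f : flagModule R x)
    (C : NeatBelow l x) : (hP.neatBasis R hl x).repr f C = f.1 C.1 := by
  rw [← Module.Basis.equivFun_apply, neatBasis, Module.Basis.equivFun_ofEquivFun]
  rfl

end NeatBasis

/-! ### The operators obtained by restriction and multiplication -/

section Operator

variable {P : Type*} [PartialOrder P] [OrderBot P] [Fintype P] {R : Type*} [CommRing R]

/-- `ext` as a map between the modules of flag functions. -/
noncomputable def IsBouquet.extHom (hP : IsBouquet P) (ω : Atom P → R) (x y : P) :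
    flagModule R y →ₗ[R] flagModule R x :=
  (ext (wt ω) x y).restrict fun _ hf => hP.ext_mem ω x hf

/-- `cut` as a map between the modules of flag functions. -/
def cutHom (R : Type*) [CommRing R] (y x : P) : flagModule R x →ₗ[R] flagModule R y :=
  (cut y).restrict fun _ hf => cut_mem_flagModule y hf

@[simp]
lemma IsBouquet.coe_extHom (hP : IsBouquet P) (ω : Atom P → R) (x y : P) (f : flagModule R y) :
    (hP.extHom ω x y f : List P → R) = ext (wt ω) x y f := rfl

@[simp]
lemma coe_cutHom (y x : P) (f : flagModule R x) : (cutHom R y x f : List P → R) = cut y f := rfl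

open Classical in
/-- The operator `∑ ext x y ∘ cut y` on the flag functions at `x`, summed over the elements `y`
covered by `x` that are not above `a`. -/
noncomputable def IsBouquet.laplacian (hP : IsBouquet P) (ω : Atom P → R) (a x : P) :
    flagModule R x →ₗ[R] flagModule R x :=
  ∑ y : P with y ⋖ x ∧ ¬ a ≤ y, hP.extHom ω x y ∘ₗ cutHom R y x

variable {a v z : P}

lemma IsBouquet.cutHom_comp_extHom_self (hP : IsBouquet P) (ω : Atom P → R) (hvz : v ⋖ z) :
    cutHom R v z ∘ₗ hP.extHom ω z v = (wt ω z - wt ω v) • LinearMap.id :=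
  LinearMap.ext fun _ => Subtype.ext (cut_ext_self _ hvz _)

open Classical in
/-- The terms of `sum_ext_cut` over the elements above `a` complement the operator. -/
lemma IsBouquet.sum_add_laplacian (hP : IsBouquet P) (ω : Atom P → R) (a x : P) :
    ∑ v : P with v ⋖ x ∧ a ≤ v, hP.extHom ω x v ∘ₗ cutHom R v x + hP.laplacian ω a x =
      wt ω x • LinearMap.id := by
  rw [laplacian, ← Finset.filter_filter, ← Finset.filter_filter,
    Finset.sum_filter_add_sum_filter_not]
  refine LinearMap.ext fun f => Subtype.ext ?_
  simpa [LinearMap.sum_apply] using sum_ext_cut ω f.2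

open Classical in
/-- The operators intertwine with the multiplication between elements above `a`. -/
lemma IsBouquet.laplacian_comp_extHom (hP : IsBouquet P) (ω : Atom P → R) (hav : a ≤ v)
    (hvz : v ⋖ z) :
    hP.laplacian ω a z ∘ₗ hP.extHom ω z v = hP.extHom ω z v ∘ₗ hP.laplacian ω a v := by
  refine LinearMap.ext fun f => Subtype.ext ?_
  simp only [laplacian, LinearMap.comp_apply, LinearMap.sum_apply, coe_extHom, coe_cutHom,
    AddSubmonoidClass.coe_finsetSum, map_sum]
  have h1 : ∀ y ∈ Finset.univ.filter fun y => y ⋖ z ∧ ¬ a ≤ y,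
      ext (wt ω) z y (cut y (ext (wt ω) z v f)) = -∑ t : P with t ⋖ v ∧ t ⋖ y,
        ext (wt ω) z y (ext (wt ω) y t (cut t (f : List P → R))) := by
    intro y hy
    simp only [Finset.mem_filter, Finset.mem_univ, true_and] at hy
    rw [cut_ext_of_ne _ hvz hy.1 (by rintro rfl; exact hy.2 hav), map_neg, map_sum]
  rw [Finset.sum_congr rfl h1, Finset.sum_neg_distrib,
    Finset.sum_comm' (t' := {t : P | t ⋖ v ∧ ¬ a ≤ t})
    (s' := fun t => ({y : P | t ⋖ y ∧ y ⋖ z} : Finset P).erase v), ← Finset.sum_neg_distrib]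
  · refine Finset.sum_congr rfl fun t ht => ?_
    simp only [Finset.mem_filter, Finset.mem_univ, true_and] at ht
    have := hP.sum_ext_ext ω z (f.2.cut_mem ht.1)
    rw [← Finset.add_sum_erase _ _ (show v ∈ Finset.univ.filter (fun y => t ⋖ y ∧ y ⋖ z) by
      simpa using ⟨ht.1, hvz⟩)] at this
    exact (eq_neg_of_add_eq_zero_left this).symm
  · intro y t
    simp only [Finset.mem_filter, Finset.mem_univ, true_and, Finset.mem_erase]
    constructor
    · rintro ⟨⟨hyz, hay⟩, htv, hty⟩
      exact ⟨⟨by rintro rfl; exact hay hav, hty, hyz⟩, htv, fun h => hay (h.trans hty.le)⟩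
    · rintro ⟨⟨hne, hty, hyz⟩, htv, hat⟩
      exact ⟨⟨hyz, fun h => hne (hP.eq_of_covBy_of_covBy hty htv h hav hat)⟩, htv, hty⟩

lemma IsBouquet.free_flagModule (hP : IsBouquet P) (x : P) : Module.Free R (flagModule R x) := by
  obtain ⟨l, hl⟩ := hP.exists_labeling
  exact Module.Free.of_basis (hP.neatBasis R hl x)

lemma IsBouquet.finite_flagModule (hP : IsBouquet P) (x : P) :
    Module.Finite R (flagModule R x) := by
  obtain ⟨l, hl⟩ := hP.exists_labeling
  exact Module.Finite.of_basis (hP.neatBasis R hl x)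

open Classical in
/-- The recursion for the traces of the powers of the operators. -/
lemma IsBouquet.trace_laplacian_pow_succ (hP : IsBouquet P) (ω : Atom P → R) (a x : P) (j : ℕ) :
    LinearMap.trace R _ (hP.laplacian ω a x ^ (j + 1)) =
      wt ω x * LinearMap.trace R _ (hP.laplacian ω a x ^ j) -
      ∑ v : P with v ⋖ x ∧ a ≤ v,
        (wt ω x - wt ω v) * LinearMap.trace R _ (hP.laplacian ω a v ^ j) := by
  have hfree := hP.free_flagModule (R := R)
  have hfin := hP.finite_flagModule (R := R)
  have hpow : ∀ v, v ⋖ x → a ≤ v → (hP.laplacian ω a x ^ j) ∘ₗ hP.extHom ω x v =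
      hP.extHom ω x v ∘ₗ (hP.laplacian ω a v ^ j) := by
    intro v hvx hav
    induction j with
    | zero => rfl
    | succ j ih =>
      rw [pow_succ', pow_succ', Module.End.mul_eq_comp, Module.End.mul_eq_comp,
        LinearMap.comp_assoc, ih, ← LinearMap.comp_assoc, hP.laplacian_comp_extHom ω hav hvx,
        LinearMap.comp_assoc]
  have hsplit := congrArg (fun S => LinearMap.trace R _ (hP.laplacian ω a x ^ j * S))
    (hP.sum_add_laplacian ω a x)
  simp only [mul_add, map_add, Finset.mul_sum, map_sum, mul_smul_comm, map_smul,
    smul_eq_mul] at hsplit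
  rw [pow_succ, eq_sub_iff_add_eq, add_comm]
  refine Eq.trans (congrArg (· + _) ?_) hsplit
  · refine Finset.sum_congr rfl fun v hv => ?_
    simp only [Finset.mem_filter, Finset.mem_univ, true_and] at hv
    -- The operator moves to `v` by the intertwining relation, and there the cyclicity of the
    -- trace leaves restriction after multiplication, which is a scalar.
    symm
    rw [Module.End.mul_eq_comp, ← LinearMap.comp_assoc, hpow v hv.1 hv.2,
      LinearMap.trace_comp_comm',
      ← LinearMap.comp_assoc, hP.cutHom_comp_extHom_self ω hv.1, LinearMap.smul_comp,
      LinearMap.id_comp, map_smul, smul_eq_mul]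

end Operator

/-! ### The rank -/

section Rank

variable {P : Type*} [PartialOrder P]

/-- There is a saturated chain of length `n` from `u` to `x`. -/
inductive SatLength (x : P) : P → ℕ → Prop
  | refl : SatLength x x 0
  | step {u v : P} {n : ℕ} : u ⋖ v → SatLength x v n → SatLength x u (n + 1)

lemma SatLength.le {x u : P} {n : ℕ} (h : SatLength x u n) : u ≤ x := by
  induction h with
  | refl => exact le_rfl
  | step huv _ ih => exact huv.le.trans ih

lemma SatLength.trans {x y u : P} {m n : ℕ} (h : SatLength y u m) (h' : SatLength x y n) :
    SatLength x u (n + m) := by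
  induction h with
  | refl => exact h'
  | step huv _ ih => exact .step huv ih

lemma exists_satLength [Finite P] {u x : P} (h : u ≤ x) : ∃ n, SatLength x u n := by
  induction u using WellFoundedGT.induction with
  | ind u ih =>
    rcases h.eq_or_lt with rfl | hlt
    · exact ⟨0, .refl⟩
    · obtain ⟨v, huv, hvx⟩ := exists_covBy_le_of_lt hlt
      obtain ⟨n, hn⟩ := ih v huv.lt hvx
      exact ⟨n + 1, .step huv hn⟩

/-- The Jordan–Dedekind chain condition. -/
lemma IsBouquet.satLength_unique [Finite P] (hP : IsBouquet P) {x u : P} {m n : ℕ}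
    (hm : SatLength x u m) (hn : SatLength x u n) : m = n := by
  induction m generalizing u n with
  | zero =>
    cases hm
    cases hn with
    | refl => rfl
    | step huv hv => exact absurd huv.lt hv.le.not_gt
  | succ m ih =>
    cases hm with
    | @step _ a _ hua ha =>
      cases hn with
      | refl => exact absurd hua.lt ha.le.not_gt
      | @step _ b n hub hb =>
        rcases eq_or_ne a b with rfl | hab
        · rw [ih ha hb]
        · obtain ⟨j, hjx, haj, hbj⟩ := hP.diamond hua hub hab ha.le hb.le
          obtain ⟨p, hp⟩ := exists_satLength hjx
          have h1 := ih ha (.step haj hp)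
          subst h1
          rw [ih (.step hbj hp) hb]

variable [OrderBot P] [Finite P]

lemma IsBouquet.exists_rank (hP : IsBouquet P) :
    ∀ x : P, SatLength x ⊥ (rank x) := by
  choose r hr using fun x : P => exists_satLength (bot_le (a := x))
  have hmono : StrictMono r := by
    intro u x hux
    obtain ⟨k, hk⟩ := exists_satLength hux.le
    rw [hP.satLength_unique (hr x) ((hr u).trans hk)]
    cases hk with
    | refl => exact absurd hux (lt_irrefl _)
    | step _ _ => omega
  have key : ∀ x, Order.height x = r x := by
    intro x
    refine le_antisymm ?_ ?_
    · simpa using Order.height_le_height_apply_of_strictMono r hmono x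
    · have : ∀ (u : P) n, SatLength x u n → Order.height u + n ≤ Order.height x := by
        intro u n h
        induction h with
        | refl => simp
        | @step u v n huv hv ih =>
          refine le_trans ?_ ih
          rw [Nat.cast_add, Nat.cast_one, add_comm (n : ℕ∞), ← add_assoc]
          exact add_le_add (Order.height_add_one_le huv.lt) le_rfl
      simpa using this ⊥ _ (hr x)
  intro x
  rw [rank, key]
  exact hr x

lemma IsBouquet.rank_covBy (hP : IsBouquet P) {z y : P} (h : z ⋖ y) : rank y = rank z + 1 := by
  rw [add_comm]
  exact hP.satLength_unique (hP.exists_rank y) ((hP.exists_rank z).trans (.step h .refl))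

end Rank

/-! ### The Möbius and the beta function -/

section Moebius

open IncidenceAlgebra

variable {P : Type*} [PartialOrder P] [Fintype P] [DecidableEq P] [LocallyFiniteOrder P]
  {a v x : P}

/-- Weisner's theorem: for `a ≤ x` and `a ≰ v` the Möbius function `μ(v, y)` sums to zero over the
`y` with `a ∨ y = x`; hence it is orthogonal to the functions of `a ∨ y`. -/
lemma sum_mu_join_eq_zero (hax : a ≤ x) (hvx : v ≤ x)
    (hav : ¬ a ≤ v) : (∀ j : P → P, (∀ y ∈ Finset.Icc v x, j y ≤ x ∧ IsLUB {a, y} (j y)) →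
      (∀ φ : P → ℤ, ∑ y ∈ Finset.Icc v x, mu ℤ v y * φ (j y) = 0) ∧
      ∑ y ∈ Finset.Icc v x with j y = x, mu ℤ v y = 0) := by
  induction x using WellFoundedLT.induction with
  | ind x ih =>
    intro j hj
    have hmaps : ∀ y ∈ Finset.Icc v x, j y ∈ Finset.Icc v x := fun y hy =>
      Finset.mem_Icc.2 ⟨(Finset.mem_Icc.1 hy).1.trans ((hj y hy).2.1 (by simp)), (hj y hy).1⟩
    have hsum : ∑ t ∈ Finset.Icc v x, ∑ y ∈ Finset.Icc v x with j y = t, mu ℤ v y = 0 := by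
      rw [Finset.sum_fiberwise_of_maps_to hmaps, sum_Icc_mu_right, if_neg]
      rintro rfl
      exact hav hax
    have hlow : ∀ t ∈ Finset.Icc v x, t ≠ x →
        ∑ y ∈ Finset.Icc v x with j y = t, mu ℤ v y = 0 := by
      intro t ht htx
      by_cases hat : a ≤ t
      · have hvt := (Finset.mem_Icc.1 ht).1
        have htx' := (Finset.mem_Icc.1 ht).2
        rw [← (ih t (lt_of_le_of_ne htx' htx) hat hvt j ?_).2]
        · congr 1
          ext y
          simp only [Finset.mem_filter, Finset.mem_Icc]
          constructor
          · rintro ⟨hy, rfl⟩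
            exact ⟨⟨hy.1, (hj y (Finset.mem_Icc.2 hy)).2.1 (by simp)⟩, rfl⟩
          · rintro ⟨hy, rfl⟩
            exact ⟨⟨hy.1, hy.2.trans htx'⟩, rfl⟩
        · intro y hy
          rw [Finset.mem_Icc] at hy
          have := (hj y (Finset.mem_Icc.2 ⟨hy.1, hy.2.trans htx'⟩)).2
          exact ⟨this.2 (by simp [upperBounds, hat, hy.2]), this⟩
      · refine Finset.sum_eq_zero fun y hy => ?_
        rw [Finset.mem_filter] at hy
        exact absurd ((hj y hy.1).2.1 (by simp)) (hy.2 ▸ hat)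
    have htop : ∑ y ∈ Finset.Icc v x with j y = x, mu ℤ v y = 0 := by
      rwa [Finset.sum_eq_single x hlow
        fun h => absurd (Finset.right_mem_Icc.2 hvx) h] at hsum
    refine ⟨fun φ => ?_, htop⟩
    rw [← Finset.sum_fiberwise_of_maps_to hmaps]
    refine Finset.sum_eq_zero fun t ht => ?_
    rw [Finset.sum_congr rfl (g := fun y => mu ℤ v y * φ t)
      fun y hy => by rw [(Finset.mem_filter.1 hy).2], ← Finset.sum_mul]
    rcases eq_or_ne t x with rfl | htx
    · rw [htop, zero_mul]
    · rw [hlow t ht htx, zero_mul]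

variable [OrderBot P]

open Classical in
/-- Weisner's recursion for the Möbius function. -/
lemma IsBouquet.mu_eq_neg_sum (hP : IsBouquet P) (ha : IsAtom a) (hax : a ≤ x) (hvx : v ≤ x)
    (hav : ¬ a ≤ v) :
    mu ℤ v x = -∑ y : P with y ⋖ x ∧ ¬ a ≤ y, mu ℤ v y := by
  obtain ⟨j, hj⟩ := hP.exists_joinFun hax
  have h0 := (sum_mu_join_eq_zero hax hvx hav j
    fun y hy => hj y (Finset.mem_Icc.1 hy).2).2
  have hset : (Finset.Icc v x).filter (fun y => j y = x) =
      insert x ((Finset.univ.filter fun y => y ⋖ x ∧ ¬ a ≤ y).filter (v ≤ ·)) := by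
    ext y
    simp only [Finset.mem_filter, Finset.mem_Icc, Finset.mem_insert, Finset.mem_univ, true_and]
    constructor
    · rintro ⟨⟨hvy, hyx⟩, hjy⟩
      have hlub := (hj y hyx).2
      rw [hjy] at hlub
      by_cases hay : a ≤ y
      · exact Or.inl (le_antisymm hyx (hlub.2 (by simp [upperBounds, hay])))
      · obtain ⟨k, _, hk, hyk⟩ := hP.exists_covBy_atom ha hax hyx hay
        obtain rfl := hlub.unique hk
        exact Or.inr ⟨⟨hyk, hay⟩, hvy⟩
    · rintro (rfl | ⟨⟨hyx, hay⟩, hvy⟩)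
      · exact ⟨⟨hvx, le_rfl⟩, le_antisymm (hj _ le_rfl).1 ((hj _ le_rfl).2.1 (by simp))⟩
      · obtain ⟨k, hkx, hk, hyk⟩ := hP.exists_covBy_atom ha hax hyx.le hay
        have hkx' : k = x := hkx.eq_of_not_lt (hyx.2 hyk.lt)
        exact ⟨⟨hvy, hyx.le⟩, ((hj y hyx.le).2.unique hk).trans hkx'⟩
  rw [hset, Finset.sum_insert (by simp), Finset.sum_filter_of_ne] at h0
  · exact eq_neg_of_add_eq_zero_left h0
  · intro y _ hy
    exact le_of_ne_zero hy

lemma neg_one_pow_mul_self (n : ℕ) : (-1 : ℤ) ^ n * (-1) ^ n = 1 := by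
  rw [← mul_pow]; simp

/-- The Möbius function alternates in sign. -/
lemma IsBouquet.neg_one_pow_mul_mu (hP : IsBouquet P) (v x : P) :
    (-1) ^ (rank v + rank x) * mu ℤ v x = |mu ℤ v x| := by
  classical
  induction x using WellFoundedLT.induction with
  | ind x ih =>
    by_cases hvx : v ≤ x
    swap
    · simp [apply_eq_zero_of_not_le hvx]
    rcases hvx.eq_or_lt with rfl | hlt
    · simp [pow_add, neg_one_pow_mul_self]
    obtain ⟨a, ha, hax, hav⟩ := hP.exists_atom hlt.not_ge
    have h1 : (-1) ^ (rank v + rank x) * mu ℤ v x =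
        ∑ y : P with y ⋖ x ∧ ¬ a ≤ y, |mu ℤ v y| := by
      rw [hP.mu_eq_neg_sum ha hax hvx hav, mul_neg, ← neg_mul, Finset.mul_sum]
      refine Finset.sum_congr rfl fun y hy => ?_
      simp only [Finset.mem_filter, Finset.mem_univ, true_and] at hy
      rw [← ih y hy.1.lt, hP.rank_covBy hy.1]
      ring
    have h2 : 0 ≤ (-1) ^ (rank v + rank x) * mu ℤ v x := by
      rw [h1]
      exact Finset.sum_nonneg fun _ _ => abs_nonneg _
    rw [← abs_of_nonneg h2, abs_mul, abs_pow]
    simp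

open Classical in
/-- The recursion for `|μ(v, x)|`; for `v = ⊥` it is the recursion for the number of neat chains. -/
lemma IsBouquet.abs_mu_eq_sum (hP : IsBouquet P) (ha : IsAtom a) (hax : a ≤ x) (hvx : v ≤ x)
    (hav : ¬ a ≤ v) : |mu ℤ v x| = ∑ y : P with y ⋖ x ∧ ¬ a ≤ y, |mu ℤ v y| := by
  rw [← hP.neg_one_pow_mul_mu, hP.mu_eq_neg_sum ha hax hvx hav, mul_neg, ← neg_mul,
    Finset.mul_sum]
  refine Finset.sum_congr rfl fun y hy => ?_
  simp only [Finset.mem_filter, Finset.mem_univ, true_and] at hy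
  rw [← hP.neg_one_pow_mul_mu v y, hP.rank_covBy hy.1]
  ring

/-- The beta function as a sum over the elements above an atom. -/
lemma IsBouquet.sum_mu_eq_beta (hP : IsBouquet P) (ha : IsAtom a) (hax : a ≤ x) :
    ∑ y ∈ Finset.Icc a x, mu ℤ ⊥ y = (-1) ^ rank x * beta x := by
  classical
  obtain ⟨j, hj⟩ := hP.exists_joinFun hax
  have h0 := (sum_mu_join_eq_zero hax bot_le (by simpa using ha.1) j
    fun y hy => hj y (Finset.mem_Icc.1 hy).2).1 fun t => (rank t : ℤ) - 1
  -- The function `r(a ∨ y) - 1` is `r(y) - 1` or `r(y)`, as `y` is above `a` or not.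
  rw [beta, ← mul_assoc, neg_one_pow_mul_self, one_mul]
  have h1 : ∀ y ∈ Finset.Icc ⊥ x, mu ℤ ⊥ y * ((rank (j y) : ℤ) - 1) =
      mu ℤ ⊥ y * (rank y : ℤ) - if a ≤ y then mu ℤ ⊥ y else 0 := by
    intro y hy
    have hyx := (Finset.mem_Icc.1 hy).2
    split_ifs with hay
    · rw [(hj y hyx).2.unique (show IsLUB {a, y} y from
        ⟨by simp [upperBounds, hay], fun t ht => ht (by simp)⟩)]
      ring
    · obtain ⟨k, _, hk, hyk⟩ := hP.exists_covBy_atom ha hax hyx hay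
      rw [(hj y hyx).2.unique hk, hP.rank_covBy hyk]
      push_cast
      ring
  rw [Finset.sum_congr rfl h1, Finset.sum_sub_distrib, sub_eq_zero, ← Finset.sum_filter] at h0
  rw [h0]
  congr 1
  ext y
  simp [and_comm]

lemma IsBouquet.card_neatBelow_eq (hP : IsBouquet P) {l : P → P} (hl : IsLabeling l) (x : P) :
    (Fintype.card (NeatBelow l x) : ℤ) = (-1) ^ rank x * mu ℤ ⊥ x := by
  classical
  have hbot : rank (⊥ : P) = 0 := by simp [rank]
  have h := hP.neg_one_pow_mul_mu ⊥ x
  rw [hbot, zero_add] at h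
  rw [h]
  clear h
  induction x using WellFoundedLT.induction with
  | ind x ih =>
    rcases eq_or_ne x ⊥ with rfl | hx
    · simp [card_neatBelow_bot]
    · rw [card_neatBelow l hx, hP.abs_mu_eq_sum (hl x hx).1 (hl x hx).2 bot_le
        (by simpa using (hl x hx).1.1), Nat.cast_sum]
      refine Finset.sum_congr rfl fun y hy => ih y ?_
      exact (Finset.mem_filter.1 hy).2.1.lt

end Moebius

/-! ### Traces of the powers of the operators -/

section Traces

open IncidenceAlgebra

variable {P : Type*} [PartialOrder P] [OrderBot P] [Fintype P] [DecidableEq P]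
  [LocallyFiniteOrder P] {R : Type*} [CommRing R] {a x : P}

lemma IsBouquet.trace_id_flagModule (hP : IsBouquet P) (x : P) :
    LinearMap.trace R (flagModule R x) 1 = ((-1) ^ rank x * mu ℤ ⊥ x : ℤ) := by
  obtain ⟨l, hl⟩ := hP.exists_labeling
  rw [← hP.card_neatBelow_eq hl, LinearMap.trace_eq_matrix_trace R (hP.neatBasis R hl x),
    LinearMap.toMatrix_one, Matrix.trace_one, Int.cast_natCast]

/-- In the alternating sum over `z` of the trace recursions the weights `w(z) - w(v)` add up, over
the covers `z` of `v`, to `w(x) - w(v)`; so each step multiplies the sum by `w(x)`. -/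
lemma IsBouquet.sum_trace_pow (hP : IsBouquet P) (ω : Atom P → R) (ha : IsAtom a) (hax : a ≤ x)
    (j : ℕ) : ∑ z ∈ Finset.Icc a x,
      (-1) ^ rank z * LinearMap.trace R _ (hP.laplacian ω a z ^ j) =
      wt ω x ^ j * ((-1) ^ rank x * beta x : ℤ) := by
  classical
  induction j with
  | zero =>
    rw [← hP.sum_mu_eq_beta ha hax, pow_zero, one_mul, Int.cast_sum]
    refine Finset.sum_congr rfl fun z _ => ?_
    rw [pow_zero, hP.trace_id_flagModule]
    push_cast
    rw [← mul_assoc, ← mul_pow]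
    simp
  | succ j ih =>
    rw [pow_succ', mul_assoc, ← ih]
    simp only [hP.trace_laplacian_pow_succ ω a _ j, mul_sub, Finset.sum_sub_distrib]
    have h1 : ∑ z ∈ Finset.Icc a x, (-1 : R) ^ rank z * ∑ v : P with v ⋖ z ∧ a ≤ v,
        (wt ω z - wt ω v) * LinearMap.trace R _ (hP.laplacian ω a v ^ j) =
        ∑ v ∈ Finset.Icc a x, -((wt ω x - wt ω v) *
          ((-1 : R) ^ rank v * LinearMap.trace R _ (hP.laplacian ω a v ^ j))) := by
      simp only [Finset.mul_sum]
      rw [Finset.sum_comm' (t' := Finset.Icc a x) (s' := fun v => {z : P | v ⋖ z ∧ z ≤ x})]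
      · refine Finset.sum_congr rfl fun v hv => ?_
        rw [← hP.sum_wt_sub ω (Finset.mem_Icc.1 hv).2, Finset.sum_mul, ← Finset.sum_neg_distrib]
        refine Finset.sum_congr rfl fun z hz => ?_
        rw [hP.rank_covBy (Finset.mem_filter.1 hz).2.1]
        ring
      · intro z v
        simp only [Finset.mem_Icc, Finset.mem_filter, Finset.mem_univ, true_and]
        constructor
        · rintro ⟨⟨_, hzx⟩, hvz, hav⟩
          exact ⟨⟨hvz, hzx⟩, hav, hvz.le.trans hzx⟩
        · rintro ⟨⟨hvz, hzx⟩, hav, _⟩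
          exact ⟨⟨hav.trans hvz.le, hzx⟩, hvz, hav⟩
    rw [h1, ← Finset.sum_sub_distrib, Finset.mul_sum]
    refine Finset.sum_congr rfl fun z _ => ?_
    ring

/-- The traces of the powers are those of an operator whose eigenvalues are the weights `w(v)`,
`a ≤ v ≤ x`, with multiplicity `β(v) |μ(v, x)|`. -/
lemma IsBouquet.trace_laplacian_pow (hP : IsBouquet P) (ω : Atom P → R) (ha : IsAtom a)
    (hax : a ≤ x) (j : ℕ) : LinearMap.trace R _ (hP.laplacian ω a x ^ j) =
      ∑ v ∈ Finset.Icc a x, ((beta v * |mu ℤ v x| : ℤ) : R) * wt ω v ^ j := by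
  classical
  set F : P → R := fun z => (-1) ^ rank z * LinearMap.trace R _ (hP.laplacian ω a z ^ j) with hF
  -- Möbius inversion over the interval `[a, x]`.
  have h1 : F x = ∑ v ∈ Finset.Icc a x, (∑ z ∈ Finset.Icc a v, F z) * (mu ℤ v x : ℤ) := by
    simp only [Finset.sum_mul]
    rw [Finset.sum_comm' (t' := Finset.Icc a x) (s' := fun z => Finset.Icc z x)]
    · simp only [← Finset.mul_sum, ← Int.cast_sum, sum_Icc_mu_left]
      rw [Finset.sum_eq_single x]
      · simp
      · intro z _ hz
        simp [hz]
      · intro h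
        exact absurd (Finset.right_mem_Icc.2 hax) h
    · intro v z
      simp only [Finset.mem_Icc]
      constructor
      · rintro ⟨⟨_, hvx⟩, haz, hzv⟩
        exact ⟨⟨hzv, hvx⟩, haz, hzv.trans hvx⟩
      · rintro ⟨⟨hzv, hvx⟩, haz, _⟩
        exact ⟨⟨haz.trans hzv, hvx⟩, haz, hzv⟩
  have h2 : LinearMap.trace R _ (hP.laplacian ω a x ^ j) = (-1) ^ rank x * F x := by
    rw [hF, ← mul_assoc, ← mul_pow]
    simp
  rw [h2, h1, Finset.mul_sum]
  refine Finset.sum_congr rfl fun v hv => ?_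
  rw [hP.sum_trace_pow ω ha (Finset.mem_Icc.1 hv).1, ← hP.neg_one_pow_mul_mu]
  push_cast
  ring

end Traces

/-! ### Determinants from power sums -/

section PowerSums

/-- Over an algebraically closed field the trace of a power is the sum of the powers of the
eigenvalues. -/
lemma trace_pow_eq_sum_roots {K V : Type*} [Field K] [IsAlgClosed K] [AddCommGroup V] [Module K V]
    [FiniteDimensional K V] [DecidableEq K] (f : Module.End K V) (j : ℕ) :
    LinearMap.trace K V (f ^ j) =
      ∑ μ ∈ f.charpoly.roots.toFinset, (f.charpoly.roots.count μ : K) * μ ^ j := by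
  classical
  have hint : DirectSum.IsInternal f.maxGenEigenspace :=
    DirectSum.isInternal_submodule_of_iSupIndep_of_iSup_eq_top
      (Module.End.independent_maxGenEigenspace f) (Module.End.iSup_maxGenEigenspace_eq_top f)
  have hmaps : ∀ (j : ℕ) (μ : K),
      Set.MapsTo (f ^ j) (f.maxGenEigenspace μ) (f.maxGenEigenspace μ) :=
    fun j μ => Module.End.mapsTo_maxGenEigenspace_of_comm ((Commute.refl f).pow_right j) μ
  have hset : {μ | f.maxGenEigenspace μ ≠ ⊥} = (f.charpoly.roots.toFinset : Set K) := by
    ext μ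
    rw [Set.mem_ofPred_eq, Finset.mem_coe, Multiset.mem_toFinset, ← Multiset.count_pos,
      Polynomial.count_roots, ← LinearMap.finrank_maxGenEigenspace_eq, pos_iff_ne_zero, ne_eq,
      ne_eq, Submodule.finrank_eq_zero]
  have hfin : {μ | f.maxGenEigenspace μ ≠ ⊥}.Finite := by
    rw [hset]
    exact Finset.finite_toSet _
  rw [LinearMap.trace_eq_sum_trace_restrict' hint hfin (hmaps j)]
  refine Finset.sum_congr (Finset.coe_injective
    (by rw [Set.Finite.coe_toFinset, hset])) fun μ _ => ?_
  rw [Polynomial.count_roots, ← LinearMap.finrank_maxGenEigenspace_eq]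
  induction j with
  | zero =>
    exact (LinearMap.trace_one K (f.maxGenEigenspace μ)).trans (by rw [pow_zero, mul_one])
  | succ j ih =>
    have hnil := Module.End.isNilpotent_restrict_maxGenEigenspace_sub_algebraMap f μ
    have := LinearMap.trace_comp_eq_mul_of_commute_of_isNilpotent
      (f := (f ^ j).restrict (hmaps j μ))
      (g := f.restrict (Module.End.mapsTo_maxGenEigenspace_of_comm (Commute.refl f) μ)) μ
      (LinearMap.ext fun v => Subtype.ext
        (LinearMap.congr_fun ((Commute.refl f).pow_left j).eq (v : V))) hnil
    refine Eq.trans this ?_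
    rw [ih]
    ring

/-- In characteristic zero the traces of the powers of a matrix determine its eigenvalues. If they
are the power sums of distinct elements with integer multiplicities, then these multiplicities are
not negative, and the determinant is the product of the elements with these multiplicities. -/
lemma det_eq_prod_of_trace_pow {R n ι : Type*} [CommRing R] [IsDomain R] [CharZero R] [Fintype n]
    [DecidableEq n] (A : Matrix n n R) (s : Finset ι) (c : ι → ℤ) (w : ι → R)
    (hw : Set.InjOn w s) (h : ∀ j : ℕ, (A ^ j).trace = ∑ i ∈ s, (c i : R) * w i ^ j) :
    (∀ i ∈ s, 0 ≤ c i) ∧ A.det = ∏ i ∈ s, w i ^ (c i).toNat := by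
  classical
  let K := AlgebraicClosure (FractionRing R)
  let φ : R →+* K := (algebraMap (FractionRing R) K).comp (algebraMap R _)
  have hφ : Function.Injective φ :=
    (algebraMap (FractionRing R) K).injective.comp (IsFractionRing.injective R _)
  have : CharZero K := charZero_of_injective_ringHom hφ
  let f : Module.End K (n → K) := Matrix.toLin' (A.map φ)
  set m := f.charpoly.roots with hm
  have hpow : ∀ j : ℕ, ∑ i ∈ s, (c i : K) * φ (w i) ^ j =
      ∑ u ∈ m.toFinset, (m.count u : K) * u ^ j := by
    intro j
    rw [← trace_pow_eq_sum_roots f j, ← Matrix.toLin'_pow, ← Matrix.map_pow,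
      Matrix.trace_toLin'_eq, ← AddMonoidHom.map_trace, h j]
    simp
  set v : ι → K := fun i => φ (w i) with hv
  have hvinj : Set.InjOn v s := fun i hi k hk hik => hw hi hk (hφ hik)
  set U := m.toFinset ∪ s.image v with hU
  -- The characters `j ↦ u ^ j` of the additive monoid `ℕ` are linearly independent.
  have hlin : ∀ u ∈ U, (m.count u : K) - ∑ i ∈ s with v i = u, (c i : K) = 0 := by
    have hli : LinearIndependent K (fun u : K => (powersHom K u : Multiplicative ℕ → K)) :=
      (linearIndependent_monoidHom (Multiplicative ℕ) K).comp _ (powersHom K).injective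
    refine linearIndependent_iff'.1 hli U _ (funext fun j => ?_)
    simp only [Finset.sum_apply, Pi.smul_apply, powersHom_apply, smul_eq_mul, Pi.zero_apply,
      sub_mul, Finset.sum_sub_distrib]
    rw [sub_eq_zero]
    have h1 : ∑ u ∈ U, (m.count u : K) * u ^ j.toAdd =
        ∑ u ∈ m.toFinset, (m.count u : K) * u ^ j.toAdd := by
      refine (Finset.sum_subset Finset.subset_union_left fun u _ hu => ?_).symm
      rw [Multiset.count_eq_zero.2 (by simpa using hu), Nat.cast_zero, zero_mul]
    rw [h1, ← hpow, ← Finset.sum_fiberwise_of_maps_to (g := v) (t := U)]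
    · refine Finset.sum_congr rfl fun u _ => ?_
      rw [Finset.sum_mul]
      refine Finset.sum_congr rfl fun i hi => ?_
      rw [← (Finset.mem_filter.1 hi).2]
    · exact fun i hi => Finset.mem_union_right _ (Finset.mem_image_of_mem _ hi)
  have hcount : ∀ i ∈ s, c i = m.count (v i) := by
    intro i hi
    have h2 := hlin (v i) (Finset.mem_union_right _ (Finset.mem_image_of_mem _ hi))
    rw [Finset.sum_eq_single i, sub_eq_zero] at h2
    · exact_mod_cast h2.symm
    · intro k hk hki
      rw [Finset.mem_filter] at hk
      exact absurd (hvinj hk.1 hi hk.2) hki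
    · intro h3
      exact (h3 (Finset.mem_filter.2 ⟨hi, rfl⟩)).elim
  have hsub : m.toFinset ⊆ s.image v := by
    intro u hu
    by_contra hus
    have h2 := hlin u (Finset.mem_union_left _ hu)
    rw [Finset.filter_eq_empty_iff.2 fun i hi h => hus (Finset.mem_image.2 ⟨i, hi, h⟩),
      Finset.sum_empty, sub_zero, Nat.cast_eq_zero, Multiset.count_eq_zero] at h2
    exact h2 (Multiset.mem_toFinset.1 hu)
  refine ⟨fun i hi => by rw [hcount i hi]; exact Int.natCast_nonneg _, hφ ?_⟩
  have hdet : φ A.det = m.prod := by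
    rw [RingHom.map_det, RingHom.mapMatrix_apply, ← LinearMap.det_toLin',
      Module.End.det_eq_prod_roots_charpoly_of_splits (IsAlgClosed.splits _)]
  rw [hdet, Finset.prod_multiset_count, Finset.prod_subset hsub, Finset.prod_image hvinj, map_prod]
  · refine Finset.prod_congr rfl fun i hi => ?_
    rw [map_pow, hcount i hi, Int.toNat_natCast]
  · intro u _ hu
    rw [Multiset.count_eq_zero.2 (by simpa using hu), pow_zero]

end PowerSums

/-! ### The determinants of the operators -/

section Determinant

open IncidenceAlgebra

variable {P : Type*} [PartialOrder P] [OrderBot P] [Fintype P]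

lemma IsBouquet.weight_injective (hP : IsBouquet P) : Function.Injective (weight (P := P)) := by
  classical
  have hcoeff : ∀ (a : Atom P) (x : P), MvPolynomial.coeff (Finsupp.single a 1) (weight x) =
      if a.1 ≤ x then 1 else 0 := by
    intro a x
    rw [weight, MvPolynomial.coeff_sum]
    simp only [MvPolynomial.coeff_X]
    rw [Finset.sum_congr rfl (g := fun b => if b = a then 1 else 0)]
    · simp
    · intro b _
      simp [Finsupp.single_left_inj]
  have hle : ∀ x y : P, weight x = weight y → x ≤ y := by
    intro x y h
    refine hP.le_of_atoms_le fun a ha hax => ?_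
    have h1 := hcoeff ⟨a, ha⟩ x
    rw [h, hcoeff, if_pos hax] at h1
    by_contra hay
    simp [hay] at h1
  exact fun x y h => le_antisymm (hle x y h) (hle y x h.symm)

variable [DecidableEq P] [LocallyFiniteOrder P] {a x : P}

/-- Only the powers of the generic weights, which are distinct, are compared here; the
non-negativity of the multiplicities comes out because they count eigenvalues. -/
lemma IsBouquet.det_laplacian (hP : IsBouquet P) (ha : IsAtom a) (hax : a ≤ x) :
    (∀ v ∈ Finset.Icc a x, 0 ≤ beta v * |mu ℤ v x|) ∧
    LinearMap.det (hP.laplacian (MvPolynomial.X (R := ℤ)) a x) =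
      ∏ v ∈ Finset.Icc a x, weight v ^ (beta v * |mu ℤ v x|).toNat := by
  classical
  obtain ⟨l, hl⟩ := hP.exists_labeling
  have := det_eq_prod_of_trace_pow
    (LinearMap.toMatrix (hP.neatBasis _ hl x) (hP.neatBasis _ hl x)
      (hP.laplacian (MvPolynomial.X (R := ℤ)) a x)) (Finset.Icc a x)
    (fun v => beta v * |mu ℤ v x|) weight hP.weight_injective.injOn ?_
  · rwa [LinearMap.det_toMatrix] at this
  · intro j
    rw [LinearMap.toMatrix_pow, ← LinearMap.trace_eq_matrix_trace]
    exact hP.trace_laplacian_pow _ ha hax j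

lemma IsBouquet.beta_nonneg (hP : IsBouquet P) (x : P) : 0 ≤ beta x := by
  rcases eq_or_ne x ⊥ with rfl | hx
  · simp [beta, rank]
  · obtain ⟨a, ha, hax, _⟩ := hP.exists_atom (z := ⊥) (x := x) (by simpa using hx)
    simpa using (hP.det_laplacian ha hax).1 x (Finset.right_mem_Icc.2 hax)

end Determinant

/-! ### Gram matrices of the neat chains -/

section Gram

lemma det_blockDiagonal' {R α : Type*} {n : α → Type*} [CommRing R] [Fintype α] [DecidableEq α]
    [∀ i, Fintype (n i)] [∀ i, DecidableEq (n i)] (d : ∀ i, Matrix (n i) (n i) R) :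
    (Matrix.blockDiagonal' d).det = ∏ i, (d i).det := by
  let _ : LinearOrder α := IsWellOrder.linearOrder WellOrderingRel
  rw [(Matrix.blockTriangular_blockDiagonal' d).det_fintype]
  refine Finset.prod_congr rfl fun k _ => ?_
  rw [← Matrix.det_submatrix_equiv_self (Equiv.sigmaSubtype k).symm]
  congr 1
  ext i j
  exact Matrix.blockDiagonal'_apply_eq d k i j

variable {P : Type*} [PartialOrder P] [OrderBot P] {R : Type*} [CommRing R]

/-- The saturated chains from `x` down to `⊥`, written from the top to the bottom and
without `x`. -/
def IsSatBelow : List P → P → Prop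
  | [], x => x = ⊥
  | y :: C, x => y ⋖ x ∧ IsSatBelow C y

lemma IsNeatBelow.isSatBelow {l : P → P} {C : List P} {x : P} (h : IsNeatBelow l C x) :
    IsSatBelow C x := by
  induction C generalizing x with
  | nil => exact h
  | cons y C ih => exact ⟨h.1, ih h.2.2⟩

variable [Fintype P]

open Classical in
/-- The flag function attached to a saturated chain: the result of successive multiplications by
the weighted sum of atoms along the chain. -/
noncomputable def dualFun (ω : Atom P → R) : List P → P → List P → R
  | [], _ => Pi.single [] 1
  | y :: C, x => ext (wt ω) x y (dualFun ω C y)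

lemma IsBouquet.dualFun_mem (hP : IsBouquet P) (ω : Atom P → R) {C : List P} {x : P}
    (h : IsSatBelow C x) : dualFun ω C x ∈ flagModule R x := by
  induction C generalizing x with
  | nil =>
    classical
    obtain rfl : x = ⊥ := h
    rw [dualFun]
    convert single_mem_flagModule_bot (P := P) (1 : R)
  | cons y C ih => exact hP.ext_mem ω x (ih h.2)

/-- The matrix of the flag functions attached to the neat chains to `x`, evaluated at these
chains. -/
noncomputable def gram (ω : Atom P → R) (l : P → P) (x : P) :
    Matrix (NeatBelow l x) (NeatBelow l x) R :=
  Matrix.of fun C C' => dualFun ω C.1 x C'.1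

variable [DecidableEq P] {l : P → P} {x : P}

open Classical in
lemma det_gram_bot (ω : Atom P → R) (l : P → P) : (gram ω l ⊥).det = 1 := by
  have hC : ∀ C : NeatBelow l ⊥, C.1 = [] := fun C => isNeatBelow_bot_iff.1 C.2
  have : gram ω l ⊥ = 1 := by
    ext C C'
    have : C = C' := Subtype.ext ((hC C).trans (hC C').symm)
    subst this
    simp [gram, hC C, dualFun]
  rw [this, Matrix.det_one]

open Classical in
lemma IsBouquet.coe_neatBasis_apply (hP : IsBouquet P) (hl : IsLabeling l)
    (C C' : NeatBelow l x) : (hP.neatBasis R hl x C).1 C'.1 = if C = C' then 1 else 0 := by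
  rw [← hP.neatBasis_repr hl, Module.Basis.repr_self, Finsupp.single_apply]

lemma IsBouquet.cutHom_neatBasis (hP : IsBouquet P) (hl : IsLabeling l) {y y' : P} (hy : y ⋖ x)
    (hly : ¬ l x ≤ y) (D : NeatBelow l y) (hy' : y' ⋖ x) (hly' : ¬ l x ≤ y') (hne : y' ≠ y) :
    cutHom R y' x (hP.neatBasis R hl x ⟨y :: D.1, hy, hly, D.2⟩) = 0 := by
  classical
  refine Subtype.ext (hP.eq_zero_of_neat hl (cutHom R y' x _).2 fun C hC => ?_)
  rw [coe_cutHom, cut_apply]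
  refine (hP.coe_neatBasis_apply hl _ ⟨y' :: C, hy', hly', hC⟩).trans (if_neg fun h => ?_)
  exact hne (List.cons.inj (congrArg Subtype.val h)).1.symm

lemma IsBouquet.cutHom_neatBasis_self (hP : IsBouquet P) (hl : IsLabeling l) {y : P} (hy : y ⋖ x)
    (hly : ¬ l x ≤ y) (D : NeatBelow l y) :
    cutHom R y x (hP.neatBasis R hl x ⟨y :: D.1, hy, hly, D.2⟩) = hP.neatBasis R hl y D := by
  classical
  refine (hP.neatBasis R hl y).ext_elem fun C => ?_
  rw [Module.Basis.repr_self, neatBasis_repr, coe_cutHom, cut_apply, Finsupp.single_apply]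
  refine (hP.coe_neatBasis_apply hl _ ⟨y :: C.1, hy, hly, C.2⟩).trans ?_
  congr 1
  simp [Subtype.ext_iff]

/-- On the dual basis the operator `laplacian` acts as the multiplication. -/
lemma IsBouquet.laplacian_neatBasis (hP : IsBouquet P) (hl : IsLabeling l) (ω : Atom P → R)
    {y : P} (hy : y ⋖ x) (hly : ¬ l x ≤ y) (D : NeatBelow l y) :
    hP.laplacian ω (l x) x (hP.neatBasis R hl x ⟨y :: D.1, hy, hly, D.2⟩) =
      hP.extHom ω x y (hP.neatBasis R hl y D) := by
  classical
  rw [laplacian, LinearMap.sum_apply, Finset.sum_eq_single y]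
  · rw [LinearMap.comp_apply, hP.cutHom_neatBasis_self hl hy hly]
  · intro y' hy' hne
    simp only [Finset.mem_filter, Finset.mem_univ, true_and] at hy'
    rw [LinearMap.comp_apply, hP.cutHom_neatBasis hl hy hly D hy'.1 hy'.2 hne, map_zero]
  · intro h
    exact (h (by simpa using ⟨hy, hly⟩)).elim

open Classical in
/-- The Gram matrix at `x` is the product of the block diagonal matrix of the Gram matrices one
step below and of the matrix of the operator. -/
lemma IsBouquet.det_gram (hP : IsBouquet P) (hl : IsLabeling l) (ω : Atom P → R) (hx : x ≠ ⊥) :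
    (gram ω l x).det = LinearMap.det (hP.laplacian ω (l x) x) *
      ∏ y : P with y ⋖ x ∧ ¬ l x ≤ y, (gram ω l y).det := by
  set b := hP.neatBasis R hl x
  set e := neatBelowEquiv l hx
  let B : Matrix (Σ y : {y : P // y ⋖ x ∧ ¬ l x ≤ y}, NeatBelow l y.1)
    (Σ y : {y : P // y ⋖ x ∧ ¬ l x ≤ y}, NeatBelow l y.1) R :=
    Matrix.blockDiagonal' fun y => gram ω l y.1
  have key : gram ω l x = B.submatrix e e *
      (LinearMap.toMatrix b b (hP.laplacian ω (l x) x)).transpose := by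
    ext C C'
    rcases hp : e C with ⟨⟨y, hy, hly⟩, D⟩
    obtain rfl : C = e.symm ⟨⟨y, hy, hly⟩, D⟩ := by rw [← hp, e.symm_apply_apply]
    rw [Matrix.mul_apply, ← e.symm.sum_comp, Fintype.sum_sigma,
      Finset.sum_eq_single ⟨y, hy, hly⟩]
    -- Expand the flag function of the chain below `y` in the neat basis at `y` before multiplying.
    · have hmem := hP.dualFun_mem ω D.2.isSatBelow
      have hsum := (hP.neatBasis R hl y).sum_repr ⟨dualFun ω D.1 y, hmem⟩
      have h1 : gram ω l x (e.symm ⟨⟨y, hy, hly⟩, D⟩) C' =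
          (hP.extHom ω x y ⟨dualFun ω D.1 y, hmem⟩).1 C'.1 := rfl
      rw [h1, ← hsum, map_sum, ← hP.neatBasis_repr hl, map_sum, Finset.sum_apply']
      refine Finset.sum_congr rfl fun E _ => ?_
      rw [map_smul, map_smul, Finsupp.smul_apply, smul_eq_mul, neatBasis_repr,
        Matrix.transpose_apply, LinearMap.toMatrix_apply, Matrix.submatrix_apply,
        e.apply_symm_apply, e.apply_symm_apply, ← hP.laplacian_neatBasis hl ω hy hly]
      exact congrArg (· * _)
        (Matrix.blockDiagonal'_apply_eq
          (fun y : {y : P // y ⋖ x ∧ ¬ l x ≤ y} => gram ω l y.1) ⟨y, hy, hly⟩ D E).symm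
    · rintro ⟨y', hy'⟩ _ hne
      refine Finset.sum_eq_zero fun E _ => ?_
      rw [Matrix.submatrix_apply, e.apply_symm_apply, e.apply_symm_apply,
        show B _ _ = 0 from Matrix.blockDiagonal'_apply_ne _ _ _ hne.symm, zero_mul]
    · intro h
      exact (h (Finset.mem_univ _)).elim
  rw [key, Matrix.det_mul, Matrix.det_submatrix_equiv_self, Matrix.det_transpose,
    LinearMap.det_toMatrix, mul_comm, det_blockDiagonal']
  congr 1
  exact (Finset.prod_subtype _ (by simp) fun y => (gram ω l y).det).symm

end Gram

/-! ### The determinants of the Gram matrices -/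

section DetGram

open IncidenceAlgebra

variable {P : Type*} [PartialOrder P] [OrderBot P] [Fintype P] [DecidableEq P]
  [LocallyFiniteOrder P] {l : P → P}

lemma IsBouquet.toNat_beta_mul (hP : IsBouquet P) (v x : P) :
    (beta v * |mu ℤ v x|).toNat = (beta v).toNat * (mu ℤ v x).natAbs := by
  rw [Int.toNat_mul (hP.beta_nonneg v) (abs_nonneg _), Int.abs_eq_natAbs, Int.toNat_natCast]

open Classical in
/-- The determinant formula for the lattice of elements below `x`. -/
lemma IsBouquet.det_gram_eq_prod (hP : IsBouquet P) (hl : IsLabeling l) (x : P) :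
    (gram (MvPolynomial.X (R := ℤ)) l x).det =
      ∏ v : P, weight v ^ ((beta v).toNat * (mu ℤ v x).natAbs) := by
  induction x using WellFoundedLT.induction with
  | ind x ih =>
    rcases eq_or_ne x ⊥ with rfl | hx
    · rw [det_gram_bot, Finset.prod_eq_one]
      intro v _
      by_cases hv : v ≤ ⊥
      · rw [le_bot_iff.1 hv]
        simp [beta, rank]
      · simp [apply_eq_zero_of_not_le hv]
    · obtain ⟨hla, hlx⟩ := hl x hx
      rw [hP.det_gram hl _ hx, (hP.det_laplacian hla hlx).2,
        Finset.prod_congr rfl fun y hy => ih y (Finset.mem_filter.1 hy).2.1.lt, Finset.prod_comm]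
      have h1 : ∏ v ∈ Finset.Icc (l x) x, weight v ^ (beta v * |mu ℤ v x|).toNat =
          ∏ v : P, if v ∈ Finset.Icc (l x) x then
            weight v ^ ((beta v).toNat * (mu ℤ v x).natAbs) else 1 := by
        rw [← Finset.prod_filter, Finset.filter_mem_eq_inter, Finset.univ_inter]
        exact Finset.prod_congr rfl fun v _ => by rw [hP.toNat_beta_mul]
      rw [h1, ← Finset.prod_mul_distrib]
      refine Finset.prod_congr rfl fun v _ => ?_
      rw [Finset.prod_pow_eq_pow_sum, ← Finset.mul_sum]
      -- The elements `v` above `l x` occur in the determinant of the operator only, the others in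
      -- the determinants one step below only.
      by_cases hlv : l x ≤ v
      · rw [Finset.sum_eq_zero, mul_zero, pow_zero, mul_one]
        · by_cases hvx : v ≤ x
          · rw [if_pos (Finset.mem_Icc.2 ⟨hlv, hvx⟩)]
          · rw [if_neg (fun h => hvx (Finset.mem_Icc.1 h).2), apply_eq_zero_of_not_le hvx,
              Int.natAbs_zero, mul_zero, pow_zero]
        · intro y hy
          rw [apply_eq_zero_of_not_le, Int.natAbs_zero]
          exact fun hvy => (Finset.mem_filter.1 hy).2.2 (hlv.trans hvy)
      · rw [if_neg (fun h => hlv (Finset.mem_Icc.1 h).1), one_mul]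
        congr 2
        by_cases hvx : v ≤ x
        · have h2 := hP.abs_mu_eq_sum hla hlx hvx hlv
          simp only [Int.abs_eq_natAbs] at h2
          exact_mod_cast h2.symm
        · rw [apply_eq_zero_of_not_le hvx, Int.natAbs_zero]
          refine Finset.sum_eq_zero fun y hy => ?_
          rw [apply_eq_zero_of_not_le, Int.natAbs_zero]
          exact fun hvy => hvx (hvy.trans (Finset.mem_filter.1 hy).2.1.le)

end DetGram

/-! ### Minors along a chain -/

section Minors

variable {P : Type*} [PartialOrder P] [OrderBot P] {R : Type*} [CommRing R]

lemma IsSatBelow.getD_le {C : List P} {x : P} (h : IsSatBelow C x) (n : ℕ) :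
    C.getD n ⊥ ≤ (x :: C).getD n ⊥ ∧ (x :: C).getD n ⊥ ≤ x := by
  induction C generalizing x n with
  | nil => cases n <;> simp
  | cons y C ih =>
    cases n with
    | zero => simpa using h.1.le
    | succ n =>
      simp only [List.getD_cons_succ]
      exact ⟨(ih h.2 n).1, (ih h.2 n).2.trans h.1.le⟩

/-- Atoms taken one from each layer of a chain to `x` have the join `x`. -/
lemma IsBouquet.le_of_forall_layer (hP : IsBouquet P) {C : List P} {x t : P} (h : IsSatBelow C x)
    (ht : ∀ n < C.length, ∃ a, a ≤ (x :: C).getD n ⊥ ∧ ¬ a ≤ C.getD n ⊥ ∧ a ≤ t) : x ≤ t := by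
  induction C generalizing x with
  | nil => exact (show x = ⊥ from h) ▸ bot_le
  | cons y C ih =>
    obtain ⟨a, hax, hay, hat⟩ := ht 0 (by simp)
    refine hP.le_of_covBy h.1 (ih h.2 fun n hn => ?_) (by simpa using hax) (by simpa using hay) hat
    simpa using ht (n + 1) (by simpa using hn)

variable [Fintype P]

/-- The matrix of the weights, for `k` systems of atom weights, of the successive differences
along a chain. -/
noncomputable def layerMatrix {k : ℕ} (η : Fin k → Atom P → R) (x : P) (C : List P) :
    Matrix (Fin k) (Fin k) R :=
  Matrix.of fun i j => wt (η j) ((x :: C).getD i ⊥) - wt (η j) (C.getD i ⊥)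

open Classical in
/-- The determinant of `layerMatrix`, as a function on the saturated chains below `x`. For the
indicator systems of `k` atoms it is the image of the product of these atoms in the Orlik–Solomon
algebra. -/
noncomputable def minor {k : ℕ} (η : Fin k → Atom P → R) (x : P) : List P → R :=
  fun C => if IsSatBelow C x ∧ C.length = k then (layerMatrix η x C).det else 0

variable {x y : P}

lemma cut_minor_zero (η : Fin 0 → Atom P → R) : cut y (minor η x) = 0 := by
  funext C
  simp [minor]

lemma cut_minor_succ {k : ℕ} (η : Fin (k + 1) → Atom P → R) (hyx : y ⋖ x) :
    cut y (minor η x) = ∑ j : Fin (k + 1), ((-1) ^ (j : ℕ) * (wt (η j) x - wt (η j) y)) •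
      minor (fun i => η (j.succAbove i)) y := by
  funext C
  rw [cut_apply, Finset.sum_apply]
  by_cases h : IsSatBelow C y ∧ C.length = k
  · rw [minor, if_pos ⟨⟨hyx, h.1⟩, by simpa using h.2⟩, Matrix.det_succ_row_zero]
    refine Finset.sum_congr rfl fun j _ => ?_
    rw [Pi.smul_apply, minor, if_pos h, smul_eq_mul]
    congr 1
  · rw [minor, if_neg (fun h' => h ⟨h'.1.2, by simpa using h'.2⟩)]
    refine (Finset.sum_eq_zero fun j _ => ?_).symm
    rw [Pi.smul_apply, minor, if_neg h, smul_zero]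

open Classical in
/-- The exchange relation for minors: after adding one row to another, the sum over the fillings of
a gap is a determinant with two equal rows. -/
lemma IsBouquet.sum_cut_cut_minor (hP : IsBouquet P) {k : ℕ} (η : Fin k → Atom P → R) (x z : P) :
    ∑ y : P with z ⋖ y ∧ y ⋖ x, cut z (cut y (minor η x)) = 0 := by
  funext C
  rw [Finset.sum_apply, Pi.zero_apply]
  rcases Finset.eq_empty_or_nonempty (Finset.univ.filter fun y : P => z ⋖ y ∧ y ⋖ x) with
    hemp | ⟨y₀, hy₀⟩
  · rw [hemp, Finset.sum_empty]
  simp only [Finset.mem_filter, Finset.mem_univ, true_and] at hy₀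
  by_cases h : IsSatBelow C z ∧ C.length + 2 = k
  swap
  · refine Finset.sum_eq_zero fun y _ => ?_
    rw [cut_apply, cut_apply, minor, if_neg]
    exact fun h' => h ⟨h'.1.2.2, by simpa using h'.2⟩
  obtain ⟨hC, rfl⟩ := h
  let N : Matrix (Fin (C.length + 2)) (Fin (C.length + 2)) R :=
    (layerMatrix η x (y₀ :: z :: C)).updateRow 0 fun j => wt (η j) x - wt (η j) z
  have h01 : (1 : Fin (C.length + 2)) ≠ 0 := by simp
  have key : ∀ y ∈ Finset.univ.filter fun y : P => z ⋖ y ∧ y ⋖ x,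
      cut z (cut y (minor η x)) C = (N.updateRow 1 fun j => wt (η j) y - wt (η j) z).det := by
    intro y hy
    simp only [Finset.mem_filter, Finset.mem_univ, true_and] at hy
    rw [cut_apply, cut_apply, minor, if_pos ⟨⟨hy.2, hy.1, hC⟩, by simp⟩,
      ← Matrix.det_updateRow_add_self _ h01.symm]
    congr 1
    ext i j
    refine Fin.cases ?_ (fun i => Fin.cases ?_ (fun i => ?_) i) i
    · simp [N, layerMatrix, Matrix.updateRow_apply, h01.symm]
    · simp [N, layerMatrix, Matrix.updateRow_apply]
    · have h2 : i.succ.succ ≠ 0 := Fin.succ_ne_zero _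
      have h3 : i.succ.succ ≠ 1 := by
        rw [← Fin.succ_zero_eq_one]
        exact fun h => Fin.succ_ne_zero _ (Fin.succ_injective _ h)
      simp [N, layerMatrix, Matrix.updateRow_apply, h2, h3]
  -- The sum over `y` is now linear in one row, which becomes equal to another row.
  rw [Finset.sum_congr rfl key]
  have hsum := (Matrix.detRowAlternating (R := R) (n := Fin (C.length + 2))).map_update_sum
    (Finset.univ.filter fun y : P => z ⋖ y ∧ y ⋖ x) 1
    (fun y => fun j => wt (η j) y - wt (η j) z) N
  refine hsum.symm.trans ?_
  refine Matrix.det_zero_of_row_eq h01.symm ?_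
  funext j
  set r : Fin (C.length + 2) → R :=
    ∑ y : P with z ⋖ y ∧ y ⋖ x, fun j => wt (η j) y - wt (η j) z with hr
  have e0 : N.updateRow 1 r 0 j = wt (η j) x - wt (η j) z := by
    rw [Matrix.updateRow_ne h01.symm]
    exact congrFun (Matrix.updateRow_self ..) j
  have e1 : N.updateRow 1 r 1 j = wt (η j) x - wt (η j) z := by
    rw [Matrix.updateRow_self, hr, Finset.sum_apply, hP.sum_wt_sub_covBy (η j) hy₀.1 hy₀.2]
  exact e0.trans e1.symm

lemma IsBouquet.minor_mem (hP : IsBouquet P) {k : ℕ} (η : Fin k → Atom P → R) (x : P) :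
    minor η x ∈ flagModule R x := by
  induction k generalizing x with
  | zero =>
    exact ⟨fun hx => by simp [minor, IsSatBelow, hx], fun y _ => cut_minor_zero η,
      fun y _ => by rw [cut_minor_zero]; exact isFlagFun_zero y, hP.sum_cut_cut_minor η x⟩
  | succ k ih =>
    refine ⟨fun _ => by simp [minor], fun y hy => ?_, fun y hy => ?_, hP.sum_cut_cut_minor η x⟩
    · funext C
      simp [minor, IsSatBelow, hy]
    · rw [cut_minor_succ η hy]
      exact (flagModule R y).sum_mem fun j _ => (flagModule R y).smul_mem _ (ih _ y)

open Classical in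
/-- The atom weights `ω`, restricted to the atoms in the `j`-th difference of a chain. -/
noncomputable def layer (ω : Atom P → R) (x : P) (C : List P) (j : ℕ) : Atom P → R :=
  fun a => if a.1 ≤ (x :: C).getD j ⊥ ∧ ¬ a.1 ≤ C.getD j ⊥ then ω a else 0

/-- The minor of the layers of a chain to `x` vanishes on the chains to elements `t` with `x ≰ t`:
some layer has no atom below `t`. -/
lemma IsBouquet.minor_layer_eq_zero (hP : IsBouquet P) (ω : Atom P → R) {C : List P} {t : P}
    (hC : IsSatBelow C x) (hxt : ¬ x ≤ t) :
    minor (fun j : Fin C.length => layer ω x C j) t = 0 := by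
  classical
  funext D
  by_contra hne
  rw [Pi.zero_apply, minor] at hne
  split_ifs at hne with h
  swap
  · exact hne rfl
  rw [Matrix.det_apply] at hne
  obtain ⟨σ, -, hσ⟩ := Finset.exists_ne_zero_of_sum_ne_zero hne
  refine hxt (hP.le_of_forall_layer hC fun n hn => ?_)
  by_contra! hn'
  have hzero : ∀ u ≤ t, wt (layer ω x C n) u = 0 := by
    intro u hu
    refine Finset.sum_eq_zero fun a ha => if_neg fun hlay => ?_
    exact hn' a.1 hlay.1 hlay.2 ((Finset.mem_filter.1 ha).2.trans hu)
  refine hσ ?_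
  rw [Finset.prod_eq_zero (Finset.mem_univ ⟨n, hn⟩), smul_zero]
  have hle := h.1.getD_le (σ ⟨n, hn⟩)
  simp only [layerMatrix, Matrix.of_apply]
  rw [hzero _ hle.2, hzero _ (hle.1.trans hle.2), sub_zero]

open Classical in
lemma wt_eq_sum_single (ω : Atom P → R) (u : P) :
    wt ω u = ∑ a, ω a * wt (Pi.single a 1) u := by
  rw [wt, Finset.sum_filter]
  refine Finset.sum_congr rfl fun a _ => ?_
  split_ifs with h
  · rw [wt_single_le h, mul_one]
  · rw [wt_single_not_le h, mul_zero]

open Classical in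
lemma ext_eq_sum_single (ω : Atom P → R) (x y : P) (f : List P → R) :
    ext (wt ω) x y f = ∑ a, ω a • ext (wt (Pi.single a 1)) x y f := by
  have key : ∀ C x y f, extAt (wt ω) C x y f =
      ∑ a, ω a * extAt (wt (Pi.single a (1 : R))) C x y f := by
    intro C
    induction C with
    | nil => simp [extAt]
    | cons y' C ih =>
      intro x y f
      simp only [extAt]
      split_ifs
      · simp only [LinearMap.smul_apply, LinearMap.proj_apply, smul_eq_mul]
        rw [wt_eq_sum_single ω x, wt_eq_sum_single ω y, ← Finset.sum_sub_distrib, Finset.sum_mul]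
        exact Finset.sum_congr rfl fun a _ => by ring
      · simp only [LinearMap.neg_apply, LinearMap.sum_apply, LinearMap.comp_apply, ih, mul_neg,
          Finset.sum_neg_distrib, Finset.mul_sum]
        rw [Finset.sum_comm]
      · simp
  funext C
  rw [Finset.sum_apply]
  exact key C x y f

lemma layerMatrix_cons_zero {k : ℕ} (θ : Atom P → R) (η : Fin k → Atom P → R) (x : P)
    (C : List P) (i : Fin (k + 1)) : layerMatrix (Fin.cons θ η) x C i 0 =
      wt θ ((x :: C).getD i ⊥) - wt θ (C.getD i ⊥) := rfl

open Classical in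
/-- The minor is linear in its first system of weights. -/
lemma minor_cons_eq_sum {k : ℕ} (θ : Atom P → R) (η : Fin k → Atom P → R) (x : P) :
    minor (Fin.cons θ η) x = ∑ a, θ a • minor (Fin.cons (Pi.single a 1) η) x := by
  funext C
  rw [Finset.sum_apply]
  simp only [Pi.smul_apply, smul_eq_mul, minor]
  split_ifs
  · simp only [Matrix.det_succ_column_zero, Finset.mul_sum]
    rw [Finset.sum_comm]
    refine Finset.sum_congr rfl fun i _ => ?_
    simp only [layerMatrix_cons_zero]
    rw [wt_eq_sum_single θ, wt_eq_sum_single θ (C.getD i ⊥), ← Finset.sum_sub_distrib,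
      Finset.mul_sum, Finset.sum_mul]
    refine Finset.sum_congr rfl fun a _ => ?_
    have hsub : (layerMatrix (Fin.cons θ η) x C).submatrix i.succAbove Fin.succ =
      (layerMatrix (Fin.cons (Pi.single a 1) η) x C).submatrix i.succAbove Fin.succ := rfl
    rw [hsub]
    ring
  · simp

open Classical in
lemma cut_minor_cons_single {k : ℕ} {a : Atom P} (η : Fin k → Atom P → R) (hax : a.1 ≤ x)
    (hyx : y ⋖ x) (hay : ¬ a.1 ≤ y) :
    cut y (minor (Fin.cons (Pi.single a 1) η) x) = minor η y := by
  funext C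
  rw [cut_apply]
  by_cases h : IsSatBelow C y ∧ C.length = k
  · rw [minor, minor, if_pos h, if_pos ⟨⟨hyx, h.1⟩, by simpa using h.2⟩,
      Matrix.det_succ_column_zero, Fin.sum_univ_succ, Finset.sum_eq_zero]
    · rw [layerMatrix_cons_zero]
      simp only [Fin.val_zero, List.getD_cons_zero, wt_single_le hax, wt_single_not_le hay]
      rw [pow_zero, sub_zero, one_mul, one_mul, add_zero]
      rfl
    · intro i _
      have hle := h.1.getD_le i
      rw [layerMatrix_cons_zero]
      simp only [Fin.val_succ, List.getD_cons_succ]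
      rw [wt_single_not_le fun h' => hay (h'.trans hle.2),
        wt_single_not_le fun h' => hay (h'.trans (hle.1.trans hle.2)), sub_zero, mul_zero, zero_mul]
  · rw [minor, minor, if_neg h, if_neg fun h' => h ⟨h'.1.2, by simpa using h'.2⟩]

/-- The flag function attached to a chain is the minor of the layers of the chain. Both sides are
linear in the weights of the top layer, which reduces the claim to single atoms. -/
lemma IsBouquet.dualFun_eq_minor (hP : IsBouquet P) (ω : Atom P → R) {C : List P}
    (hC : IsSatBelow C x) :
    dualFun ω C x = minor (fun j : Fin C.length => layer ω x C j) x := by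
  classical
  induction C generalizing x with
  | nil =>
    funext D
    obtain rfl : x = ⊥ := hC
    cases D with
    | nil => simp [dualFun, minor, IsSatBelow]
    | cons y D => simp [dualFun, minor]
  | cons y C ih =>
    obtain ⟨hyx, hC⟩ := hC
    set η : Fin C.length → Atom P → R := fun j => layer ω y C j with hη
    have hcons : (fun j : Fin (y :: C).length => layer ω x (y :: C) j) =
        Fin.cons (layer ω x (y :: C) 0) η := by
      funext j
      refine Fin.cases rfl (fun j => ?_) j
      funext a
      simp [layer, hη]
    rw [hcons, minor_cons_eq_sum, dualFun, ih hC, ext_eq_sum_single]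
    refine Finset.sum_congr rfl fun a _ => ?_
    have hmem := hP.minor_mem η y
    by_cases hax : a.1 ≤ x
    swap
    · rw [ext_eq_zero fun u hu => wt_single_not_le fun h => hax (h.trans hu)]
      simp [layer, hax]
    by_cases hay : a.1 ≤ y
    -- An atom below `y` is not in the layer, and multiplication by it from `y` to `x` vanishes.
    · rw [hP.eq_zero_of_cut_eq_zero a.2.1 hax (hP.ext_mem (Pi.single a 1) x hmem)]
      · simp [layer, hay]
      · intro y' _ hay'
        rw [cut_ext_single hax hay' hyx, if_neg]
        rintro rfl
        exact hay' hay
    -- For an atom in the layer, the two sides have the same restrictions away from `a`.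
    · have hω : layer ω x (y :: C) 0 a = ω a := if_pos ⟨hax, hay⟩
      have h0 := hP.eq_zero_of_cut_eq_zero a.2.1 hax (f := ext (wt (Pi.single a 1)) x y
        (minor η y) - minor (Fin.cons (Pi.single a 1) η) x) ((flagModule R x).sub_mem
          (hP.ext_mem _ _ hmem) (hP.minor_mem _ x)) ?_
      · rw [hω, ← sub_eq_zero, ← smul_sub, h0, smul_zero]
      · intro y' hy'x hay'
        rw [map_sub, cut_ext_single hax hay' hyx, cut_minor_cons_single η hax hy'x hay']
        split_ifs with h
        · rw [h, sub_self]
        · rw [hη, hP.minor_layer_eq_zero ω hC, sub_zero]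
          exact fun hle => h ((hyx.eq_or_eq hle hy'x.le).resolve_right hy'x.ne)

end Minors

/-! ### The entries of the chain matrix -/

section Entries

variable {P : Type*} [PartialOrder P] [OrderBot P]

lemma isChain_getD_covBy {C : List P} (hC : List.IsChain (· ⋖ ·) (⊥ :: C)) {i : ℕ}
    (hi : i < C.length) : (⊥ :: C).getD i ⊥ ⋖ C.getD i ⊥ := by
  have h := List.isChain_iff_getElem.1 hC i (by simpa using hi)
  rw [List.getD_eq_getElem _ _ (by simp; omega), List.getD_eq_getElem _ _ hi]
  simpa using h

/-- A tuple of atoms generates a saturated chain if and only if its `i`-th entry lies below the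
`i`-th element of the chain but not below the one before. -/
lemma IsBouquet.generates_iff (hP : IsBouquet P) {k : ℕ} (a : Fin k → Atom P) {C : List P}
    (hC : List.IsChain (· ⋖ ·) (⊥ :: C)) : Generates a C ↔ C.length = k ∧
      ∀ i : Fin k, (a i).1 ≤ C.getD i ⊥ ∧ ¬ (a i).1 ≤ (⊥ :: C).getD i ⊥ := by
  constructor
  · rintro ⟨x, rfl, hx⟩
    refine ⟨List.length_ofFn, fun i => ?_⟩
    have hxD : ∀ i : Fin k, (List.ofFn x).getD i ⊥ = x i := fun i => by
      rw [List.getD_eq_getElem _ _ (by simp)]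
      simp
    have hcov := isChain_getD_covBy hC (i := i) (by simp)
    rw [hxD] at hcov ⊢
    have hai : (a i).1 ≤ x i := (hx i).1 ⟨i, Set.mem_Iic.2 le_rfl, rfl⟩
    refine ⟨hai, fun hle => ?_⟩
    obtain ⟨n, hn⟩ := i
    cases n with
    | zero => exact (a _).2.1 (le_bot_iff.1 (by simpa using hle))
    | succ n =>
      have hD := hxD ⟨n, by omega⟩
      simp only [List.getD_cons_succ] at hcov hle hD
      rw [hD] at hcov hle
      refine hcov.lt.not_ge ((hx ⟨n + 1, hn⟩).2 ?_)
      rintro _ ⟨j, hj, rfl⟩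
      rcases (Set.mem_Iic.1 hj).eq_or_lt with rfl | hlt
      · exact hle
      · exact (hx ⟨n, by omega⟩).1 ⟨j, Nat.lt_succ_iff.1 hlt, rfl⟩
  · rintro ⟨rfl, h⟩
    have hmono : ∀ m n : ℕ, m ≤ n → n < C.length → C.getD m ⊥ ≤ C.getD n ⊥ := by
      intro m n hmn hn
      induction n, hmn using Nat.le_induction with
      | base => exact le_rfl
      | succ n _ ih =>
        refine (ih (by omega)).trans ?_
        simpa using (isChain_getD_covBy hC hn).le
    refine ⟨fun i => C.getD i ⊥, ?_, fun i => ⟨?_, fun t ht => ?_⟩⟩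
    · refine List.ext_getElem (by simp) fun n h1 h2 => ?_
      simp
    · rintro _ ⟨j, hj, rfl⟩
      exact (h j).1.trans (hmono j i (Set.mem_Iic.1 hj) i.2)
    · have key : ∀ n, n ≤ i.1 + 1 → (⊥ :: C).getD n ⊥ ≤ t := by
        intro n
        induction n with
        | zero => intro _; simp
        | succ n ih =>
          intro hn
          have hnC : n < C.length := by omega
          have hat : (a ⟨n, hnC⟩).1 ≤ t :=
            ht ⟨⟨n, hnC⟩, Set.mem_Iic.2 (Fin.mk_le_of_le_val (by simpa using hn)), rfl⟩
          rw [List.getD_cons_succ]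
          exact hP.le_of_covBy (isChain_getD_covBy hC hnC) (ih (by omega)) (h ⟨n, hnC⟩).1
            (h ⟨n, hnC⟩).2 hat
      simpa using key (i.1 + 1) le_rfl

/-- The maximal chains list their elements upwards, the chains below an element downwards. -/
lemma getD_of_reverse_eq {C D : List P} {x : P} (h : (⊥ :: C).reverse = x :: D) :
    D.length = C.length ∧ ∀ i < C.length, (x :: D).getD (C.length - (i + 1)) ⊥ = C.getD i ⊥ ∧
      D.getD (C.length - (i + 1)) ⊥ = (⊥ :: C).getD i ⊥ := by
  have hlen : D.length = C.length := by
    have := congrArg List.length h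
    simpa using this.symm
  refine ⟨hlen, fun i hi => ?_⟩
  have h1 : ∀ n ≤ C.length, (x :: D).getD n ⊥ = (⊥ :: C).getD (C.length - n) ⊥ := by
    intro n hn
    rw [← h, List.getD_reverse n (by simp; omega)]
    simp
  constructor
  · rw [h1 _ (by omega), show C.length - (C.length - (i + 1)) = i + 1 by omega,
      List.getD_cons_succ]
  · rw [← List.getD_cons_succ (x := x), h1 _ (by omega),
      show C.length - (C.length - (i + 1) + 1) = i by omega]

variable [Fintype P]

open Classical in
/-- The determinant of the matrix of the weights of the atoms that satisfy `p j` and `q i`, expanded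
over the tuples of atoms that satisfy `p` and, after a permutation, `q`. -/
lemma det_pairing_eq_sum {R : Type*} [CommRing R] (ω : Atom P → R) {k : ℕ}
    (p q : Fin k → Atom P → Prop) :
    (Matrix.of fun i j : Fin k => ∑ a, if p j a ∧ q i a then ω a else 0).det =
      ∑ a : Fin k → Atom P, ∑ σ : Equiv.Perm (Fin k),
        if (∀ i, p i (a i)) ∧ ∀ i, q i (a (σ i)) then
          (Equiv.Perm.sign σ : ℤ) • ∏ i, ω (a i) else 0 := by
  rw [Matrix.det_apply, Finset.sum_comm, ← Equiv.sum_comp (Equiv.inv _)]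
  refine Finset.sum_congr rfl fun σ _ => ?_
  simp only [Matrix.of_apply, Finset.prod_univ_sum, Fintype.piFinset_univ, Fintype.prod_ite_zero]
  rw [Finset.smul_sum]
  refine Finset.sum_congr rfl fun a _ => ?_
  have hiff : (∀ i, p i (a i) ∧ q ((Equiv.inv _ σ) i) (a i)) ↔
      (∀ i, p i (a i)) ∧ ∀ i, q i (a (σ i)) := by
    rw [forall_and]
    refine and_congr_right fun _ => ⟨fun h i => by simpa using h (σ i), fun h i => ?_⟩
    simpa using h (σ⁻¹ i)
  simp only [hiff]
  split_ifs
  · rw [Units.smul_def]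
    simp
  · rw [smul_zero]

/-- The entry at `(C, C')` of the chain matrix is the minor of the layers of `C` along `C'`. -/
lemma IsBouquet.chainMatrix_apply (hP : IsBouquet P) {l : P → P} (C C' : NeatChain l)
    {D D' : List P} {x x' : P} (h : (⊥ :: C.1).reverse = x :: D)
    (h' : (⊥ :: C'.1).reverse = x' :: D') (hD' : IsSatBelow D' x') :
    chainMatrix l C C' = minor
      (fun j : Fin C.1.length => layer (MvPolynomial.X (R := ℤ)) x D j) x' D' := by
  classical
  have hC := C.2.1.1
  have hC' := C'.2.1.1
  obtain ⟨hlen, hget⟩ := getD_of_reverse_eq h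
  obtain ⟨hlen', hget'⟩ := getD_of_reverse_eq h'
  rw [chainMatrix, Matrix.of_apply]
  by_cases hk : C'.1.length = C.1.length
  swap
  · rw [minor, if_neg fun h => hk (hlen'.symm.trans h.2)]
    refine Finset.sum_eq_zero fun a _ => Finset.sum_eq_zero fun σ _ => if_neg fun h => hk ?_
    exact ((hP.generates_iff _ hC').1 h.2).1
  rw [minor, if_pos ⟨hD', hlen'.trans hk⟩,
    ← Matrix.det_submatrix_equiv_self Fin.revPerm]
  let p (i : Fin C.1.length) (a : Atom P) : Prop :=
    a.1 ≤ C.1.getD i ⊥ ∧ ¬ a.1 ≤ (⊥ :: C.1).getD i ⊥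
  let q (i : Fin C.1.length) (a : Atom P) : Prop :=
    a.1 ≤ C'.1.getD i ⊥ ∧ ¬ a.1 ≤ (⊥ :: C'.1).getD i ⊥
  have hentry : (layerMatrix (fun j : Fin C.1.length => layer (MvPolynomial.X (R := ℤ)) x D j)
      x' D').submatrix Fin.revPerm Fin.revPerm = Matrix.of fun i j : Fin C.1.length =>
      ∑ a : Atom P, if p j a ∧ q i a then (MvPolynomial.X a : MvPolynomial (Atom P) ℤ) else 0 := by
    ext1 i j
    have hiC : (i : ℕ) < C'.1.length := by omega
    have hi := hget' i hiC
    rw [hk] at hi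
    simp only [Matrix.submatrix_apply, layerMatrix, Matrix.of_apply, Fin.revPerm_apply,
      Fin.val_rev, hi]
    rw [wt_sub_wt _ (isChain_getD_covBy hC' hiC).le, Finset.sum_filter]
    refine Finset.sum_congr rfl fun a _ => ?_
    rw [layer, (hget j j.2).1, (hget j j.2).2, ← ite_and]
    exact if_congr and_comm rfl rfl
  rw [hentry]
  refine Eq.trans ?_ ((det_pairing_eq_sum MvPolynomial.X p q).symm.trans (by congr!))
  refine Finset.sum_congr rfl fun a _ => Finset.sum_congr rfl fun σ _ => ?_
  have hiff : Generates a C.1 ∧ Generates (a ∘ σ) C'.1 ↔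
      (∀ i, p i (a i)) ∧ ∀ i, q i (a (σ i)) := by
    rw [hP.generates_iff _ hC, hP.generates_iff _ hC', and_iff_right rfl, and_iff_right hk]
    rfl
  simp only [hiff]
  congr

end Entries

/-! ### Neat maximal chains, from the top and from the bottom -/

section NeatChains

variable {P : Type*} [PartialOrder P] [OrderBot P] {l : P → P}

lemma isNeatBelow_iff {D : List P} {r : P} : IsNeatBelow l D r ↔
    List.IsChain (fun x y => y ⋖ x ∧ ¬ l x ≤ y) (r :: D) ∧
      (r :: D).getLast (List.cons_ne_nil _ _) = ⊥ := by
  induction D generalizing r with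
  | nil => simp [IsNeatBelow]
  | cons y D ih =>
    rw [IsNeatBelow, ih, List.isChain_cons_cons, List.getLast_cons (List.cons_ne_nil _ _)]
    tauto

/-- In a saturated chain the condition `l x ≤ x` of neatness is automatic, because only the first
element can be `⊥`. -/
lemma isChain_covBy_and_iff (hl : IsLabeling l) {L : List P} :
    List.IsChain (· ⋖ ·) L ∧ List.IsChain (fun y x => l x ≤ x ∧ ¬ l x ≤ y) L ↔
      List.IsChain (fun y x => y ⋖ x ∧ ¬ l x ≤ y) L := by
  induction L with
  | nil => simp
  | cons x L ih =>
    cases L with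
    | nil => simp
    | cons y L =>
      simp only [List.isChain_cons_cons] at ih ⊢
      rw [← ih]
      constructor
      · rintro ⟨⟨h1, h2⟩, ⟨_, h3⟩, h4⟩
        exact ⟨⟨h1, h3⟩, h2, h4⟩
      · rintro ⟨⟨h1, h3⟩, h2, h4⟩
        exact ⟨⟨h1, h2⟩, ⟨(hl y (bot_le.trans_lt h1.lt).ne').2, h3⟩, h4⟩

lemma isMaxChain_and_isNeat_iff (hl : IsLabeling l) {C D : List P} {r : P}
    (h : (⊥ :: C).reverse = r :: D) :
    IsMaxChain C ∧ IsNeat l C ↔ IsMax r ∧ IsNeatBelow l D r := by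
  have hlast : (⊥ :: C).getLast (List.cons_ne_nil _ _) = r := by
    rw [← List.head_reverse (by simp)]
    simp only [h, List.head_cons]
  have hlast' : (r :: D).getLast (List.cons_ne_nil _ _) = ⊥ := by
    simp only [← h, List.getLast_reverse, List.head_cons]
  rw [isNeatBelow_iff, IsMaxChain, IsNeat, hlast, and_iff_left hlast', ← h, List.isChain_reverse,
    ← isChain_covBy_and_iff hl]
  tauto

lemma exists_reverse_eq {D : List P} {r : P} (h : IsNeatBelow l D r) :
    (⊥ :: (r :: D).reverse.tail).reverse = r :: D := by
  have h1 : (r :: D).reverse = ⊥ :: (r :: D).reverse.tail := by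
    conv_lhs => rw [← List.cons_head_tail (l := (r :: D).reverse) (by simp)]
    rw [List.head_reverse, (isNeatBelow_iff.1 h).2]
  rw [← h1, List.reverse_reverse]

/-- The neat maximal chain of the bouquet given by a neat chain from a maximal element down
to `⊥`. -/
def neatChainOfBelow (hl : IsLabeling l) (p : Σ r : {r : P // IsMax r}, NeatBelow l r.1) :
    NeatChain l :=
  ⟨(p.1.1 :: p.2.1).reverse.tail,
    (isMaxChain_and_isNeat_iff hl (exists_reverse_eq p.2.2)).2 ⟨p.1.2, p.2.2⟩⟩

lemma reverse_neatChainOfBelow (hl : IsLabeling l)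
    (p : Σ r : {r : P // IsMax r}, NeatBelow l r.1) :
    (⊥ :: (neatChainOfBelow hl p).1).reverse = p.1.1 :: p.2.1 := exists_reverse_eq p.2.2

lemma neatChainOfBelow_bijective (hl : IsLabeling l) :
    Function.Bijective (neatChainOfBelow hl) := by
  constructor
  · intro p q hpq
    have h := (reverse_neatChainOfBelow hl p).symm.trans
      (hpq ▸ reverse_neatChainOfBelow hl q)
    obtain ⟨⟨r, hr⟩, ⟨D, hD⟩⟩ := p
    obtain ⟨⟨r', hr'⟩, ⟨D', hD'⟩⟩ := q
    obtain ⟨rfl, rfl⟩ := List.cons.inj h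
    rfl
  · intro C
    obtain ⟨r, D, h⟩ := List.exists_cons_of_ne_nil (show (⊥ :: C.1).reverse ≠ [] by simp)
    have hC := (isMaxChain_and_isNeat_iff hl h).1 C.2
    refine ⟨⟨⟨r, hC.1⟩, ⟨D, hC.2⟩⟩, Subtype.ext ?_⟩
    change (r :: D).reverse.tail = C.1
    rw [← h, List.reverse_reverse, List.tail_cons]

end NeatChains

/-! ### The determinant of the chain matrix -/

section Final

open IncidenceAlgebra

variable {P : Type*} [PartialOrder P] [OrderBot P] [Fintype P] [DecidableEq P] {l : P → P}

open Classical in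
/-- The chain matrix is block diagonal, with the Gram matrices at the maximal elements as
blocks. -/
lemma IsBouquet.det_chainMatrix (hP : IsBouquet P) (hl : IsLabeling l) :
    (chainMatrix l).det = ∏ r : P with IsMax r, (gram (MvPolynomial.X (R := ℤ)) l r).det := by
  let e := Equiv.ofBijective _ (neatChainOfBelow_bijective hl)
  have key : (chainMatrix l).submatrix e e = Matrix.blockDiagonal'
      fun r : {r : P // IsMax r} => gram (MvPolynomial.X (R := ℤ)) l r.1 := by
    ext1 ⟨r, D⟩ ⟨r', D'⟩
    have hrev := reverse_neatChainOfBelow hl ⟨r, D⟩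
    have happ := hP.chainMatrix_apply (e ⟨r, D⟩) (e ⟨r', D'⟩) hrev
      (reverse_neatChainOfBelow hl ⟨r', D'⟩) D'.2.isSatBelow
    rw [Matrix.submatrix_apply, happ, show (e ⟨r, D⟩).1.length = D.1.length from
      (getD_of_reverse_eq hrev).1.symm]
    by_cases hrr : r = r'
    · subst hrr
      rw [Matrix.blockDiagonal'_apply_eq, ← hP.dualFun_eq_minor _ D.2.isSatBelow]
      rfl
    · rw [Matrix.blockDiagonal'_apply_ne _ _ _ hrr,
        hP.minor_layer_eq_zero _ D.2.isSatBelow, Pi.zero_apply]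
      exact fun hle => hrr (Subtype.ext (r.2.eq_of_le hle))
  rw [← Matrix.det_submatrix_equiv_self e, key, det_blockDiagonal']
  exact (Finset.prod_subtype _ (by simp)
    fun r => (gram (MvPolynomial.X (R := ℤ)) l r).det).symm

variable [LocallyFiniteOrder P]

open Classical in
/-- The condition `x ≤ r` in the definition of `rho` may be dropped, since `μ(x, r) = 0` without
it. -/
lemma IsBouquet.rho_eq (hP : IsBouquet P) (x : P) :
    rho x = (((beta x).toNat * ∑ r : P with IsMax r, (mu ℤ x r).natAbs : ℕ) : ℤ) := by
  rw [rho, Nat.cast_mul, Int.toNat_of_nonneg (hP.beta_nonneg x), Nat.cast_sum]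
  congr 1
  rw [← Finset.filter_filter, Finset.sum_filter_of_ne]
  · exact Finset.sum_congr rfl fun r _ => Int.abs_eq_natAbs _
  · intro r _ hr
    exact le_of_ne_zero (abs_ne_zero.1 hr)

end Final

end Bouquet

theorem theorem1p4 {P : Type*} [PartialOrder P] [OrderBot P] [Fintype P] [DecidableEq P]
    [LocallyFiniteOrder P] (hP : Bouquet.IsBouquet P)
    (l : P → P) (hl : Bouquet.IsLabeling l) :
    (∀ x : P, 0 ≤ Bouquet.rho x) ∧
    ((Bouquet.chainMatrix l).det = ∏ x : P, Bouquet.weight x ^ (Bouquet.rho x).toNat ∨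
      (Bouquet.chainMatrix l).det = -∏ x : P, Bouquet.weight x ^ (Bouquet.rho x).toNat) := by
  classical
  refine ⟨fun x => by rw [hP.rho_eq]; exact Int.natCast_nonneg _, Or.inl ?_⟩
  rw [hP.det_chainMatrix hl, Finset.prod_congr rfl fun r _ => hP.det_gram_eq_prod hl r,
    Finset.prod_comm]
  refine Finset.prod_congr rfl fun x _ => ?_
  rw [Finset.prod_pow_eq_pow_sum, ← Finset.mul_sum, hP.rho_eq, Int.toNat_natCast]
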